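/- **Bicomplex notation.** Let $\mathbb{BC}=\{Z=z_1+jz_2:\ z_1,z_2\in\mathbb C\}$, with $i^2=j^2=-1$ and $ij=ji$, be the bicomplex numbers, with Euclidean norm $|Z|^2=|z_1|^2+|z_2|^2$. Put $e_\pm=\frac{1\pm ij}{2}$ and write $Z=Z^+e_++Z^-e_-$ with $Z^\pm=z_1\mp iz_2\in\mathbb C$. Let $Z^*=\bar z_1-j\bar z_2$ and $Z^\dagger=z_1-jz_2$. For $z_\ell=x_\ell+iy_\ell$ put $X_e=x_1e_++x_2e_-$ and $Y_e=y_1e_++y_2e_-$. Let $\sigma>0$ and let $\nu,\mu\in\mathbb{BC}$ satisfy $\nu^2=\mu^2=-1$. Put $Z^e=(x_1+\nu y_1)e_++(x_2+\mu y_2)e_-$, so that $(Z^e)^+=x_1+\nu^+y_1$ and $(Z^e)^-=x_2+\mu^-y_2$, with $\nu^+,\mu^-\in\{i,-i\}$. **Spaces.** $L^2_{\mathbb{BC}}(\mathbb R)$ consists of the square integrable functions $\mathbb R\to\mathbb{BC}$ (Lebesgue measure), and $L^2_{\mathbb{BC}}(\mathbb{BC})$ of the square integrable functions $\mathbb{BC}\to\mathbb{BC}$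 for the normalized measure $d\lambda(Z)=\frac14\,dx_1dy_1dx_2dy_2$. Both carry the bicomplex scalar product $\langle f,g\rangle=\int f\,g^*$ and the norm $\|f\|^2=\int|f|^2$. **Transform.** For $\varphi,\psi\in L^2_{\mathbb{BC}}(\mathbb R)$ let $$\mathcal V(\varphi,\psi)(Z)=\frac{\sigma}{\pi}\,e^{-\frac{\sigma}{4}\left((X_e^\dagger)^2+(Y_e^\dagger)^2\right)}\int_{\mathbb R}\varphi(t)\,e^{\sigma(\nu e_++\mu e_-)\left(t-\frac{X_e}{2}\right)Y_e}\,\bigl(\psi^+(t-x_1)e_++\psi^-(t-x_2)e_-\bigr)^*\,dt ,$$ and let $h^\sigma_n(t)=(-1)^ne^{\frac{\sigma}{2}t^2}\frac{d^n}{dt^n}e^{-\sigma t^2}$. **Target.** For $\alpha>0$ and $k\ge 0$ let $\mathcal P_k^\alpha$ be the space of smooth $F:\mathbb C\to\mathbb C$ with $\partial_{\bar z}^kF=0$ and $\int_{\mathbb C}|F|^2e^{-\alpha|z|^2}<\infty$ (so $\mathcal P^\alpha_0=\{0\}$). The true-poly-Fock space $\mathcal F_n^{\alpha}$ of level $n$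 is the set of $F\in\mathcal P^\alpha_{n+1}$ with $\int_{\mathbb C} F\,\overline G\,e^{-\alpha|z|^2}=0$ for all $G\in\mathcal P_n^\alpha$. Let $\mathcal M_n$ be the set of all functions $$\Upsilon(Z)=e^{-\frac{\sigma}{2}|Z^e|^2}\Bigl(F\bigl((Z^e)^+\bigr)e_++G\bigl((Z^e)^-\bigr)e_-\Bigr),\qquad F,G\in\mathcal F_n^{\sigma/2}.$$ **Theorem.** For every $n\in\{0,1,2,\dots\}$ the space $\mathcal M_n$ is a closed subspace of $L^2_{\mathbb{BC}}(\mathbb{BC})$, hence a Hilbert space. For $f\in L^2_{\mathbb{BC}}(\mathbb R)$ the integral defining $$\mathcal S_nf=\frac{(\sigma/\pi)^{1/4}}{\sqrt{2^n\sigma^n\,n!}}\;\mathcal V(f,h^\sigma_n)$$ converges absolutely for every $Z\in\mathbb{BC}$, and $\mathcal S_nf$ depends only on the almost-everywhere class of $f$. The map $\mathcal S_n$ is a $\mathbb{BC}$-linear isometry from $L^2_{\mathbb{BC}}(\mathbb R)$ onto $\mathcal M_n$: one has $\mathcal S_nf\in\mathcal M_n$, $\langle\mathcal S_nf,\mathcal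 S_ng\rangle=\langle f,g\rangle$ and $\|\mathcal S_nf\|=\|f\|$ for all $f,g\in L^2_{\mathbb{BC}}(\mathbb R)$, and every element of $\mathcal M_n$ is $\mathcal S_nf$ for some $f\in L^2_{\mathbb{BC}}(\mathbb R)$. -/

import Mathlib

open MeasureTheory
open scoped ContDiff ENNReal

noncomputable section

/-- Bicomplex numbers `Z = z₁ + j z₂` with `z₁ = Z.re`, `z₂ = Z.im` complex and `j² = -1`. -/
abbrev Bicomplex : Type := QuadraticAlgebra ℂ (-1) 0

namespace Bicomplex

/-- Real numbers as bicomplex numbers. -/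
def ofReal (t : ℝ) : Bicomplex := ⟨(t : ℂ), 0⟩

/-- The idempotent `e₊ = (1 + ij)/2`. -/
def ePlus : Bicomplex := ⟨1 / 2, Complex.I / 2⟩

/-- The idempotent `e₋ = (1 - ij)/2`. -/
def eMinus : Bicomplex := ⟨1 / 2, -(Complex.I / 2)⟩

/-- The component `Z⁺` of `Z = Z⁺ e₊ + Z⁻ e₋`. -/
def plus (Z : Bicomplex) : ℂ := Z.re - Complex.I * Z.im

/-- The component `Z⁻` of `Z = Z⁺ e₊ + Z⁻ e₋`. -/
def minus (Z : Bicomplex) : ℂ := Z.re + Complex.I * Z.im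

theorem idempotent_decomposition (Z : Bicomplex) :
    Z = plus Z • ePlus + minus Z • eMinus := by
  ext
  · simp only [plus, minus, ePlus, eMinus, QuadraticAlgebra.re_add, QuadraticAlgebra.re_smul,
      smul_eq_mul]
    ring
  · simp only [plus, minus, ePlus, eMinus, QuadraticAlgebra.im_add, QuadraticAlgebra.im_smul,
      smul_eq_mul]
    linear_combination (Z.im) * Complex.I_sq

/-- The conjugation `Z* = z̄₁ - j z̄₂`. -/
def conj (Z : Bicomplex) : Bicomplex :=
  ⟨(starRingEnd ℂ) Z.re, -(starRingEnd ℂ) Z.im⟩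

/-- The bicomplex exponential `e^Z = e^{z₁} (cos z₂ + j sin z₂)`. -/
def exp (Z : Bicomplex) : Bicomplex :=
  ⟨Complex.exp Z.re * Complex.cos Z.im, Complex.exp Z.re * Complex.sin Z.im⟩

/-- The identification of the bicomplex numbers with the Hilbert space `ℂ²`. -/
def toL2 : Bicomplex →ₗ[ℂ] WithLp 2 (ℂ × ℂ) where
  toFun Z := WithLp.toLp 2 (Z.re, Z.im)
  map_add' _ _ := rfl
  map_smul' _ _ := rfl

theorem toL2_injective : Function.Injective toL2 := by
  intro Z W h
  have h' : (Z.re, Z.im) = (W.re, W.im) := congrArg WithLp.ofLp h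
  exact QuadraticAlgebra.ext (congrArg Prod.fst h') (congrArg Prod.snd h')

/-- The Euclidean norm `|Z| = √(|z₁|² + |z₂|²)`. -/
instance : NormedAddCommGroup Bicomplex :=
  NormedAddCommGroup.induced Bicomplex (WithLp 2 (ℂ × ℂ)) toL2 toL2_injective

instance : NormedSpace ℂ Bicomplex :=
  NormedSpace.induced ℂ Bicomplex (WithLp 2 (ℂ × ℂ)) toL2

instance : NormedSpace ℝ Bicomplex :=
  NormedSpace.induced ℝ Bicomplex (WithLp 2 (ℂ × ℂ)) (toL2.restrictScalars ℝ)

instance : CompleteSpace Bicomplex := FiniteDimensional.complete ℂ Bicomplex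

instance : MeasurableSpace Bicomplex := borel Bicomplex

instance : BorelSpace Bicomplex := ⟨rfl⟩

theorem norm_sq_eq (Z : Bicomplex) : ‖Z‖ ^ 2 = ‖Z.re‖ ^ 2 + ‖Z.im‖ ^ 2 :=
  WithLp.prod_norm_sq_eq_of_L2 (toL2 Z)

theorem measurable_mk : Measurable (fun p : ℂ × ℂ => (⟨p.1, p.2⟩ : Bicomplex)) := by
  have h : Continuous (fun p : ℂ × ℂ => (⟨p.1, p.2⟩ : Bicomplex)) :=
    LinearMap.continuous_of_finiteDimensional
      ({ toFun := fun p => ⟨p.1, p.2⟩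
         map_add' := fun _ _ => rfl
         map_smul' := fun _ _ => rfl } : ℂ × ℂ →ₗ[ℂ] Bicomplex)
  exact h.measurable

/-- The measure `dλ(Z) = ¼ dx₁ dy₁ dx₂ dy₂` on the bicomplex numbers
(`z₁ = x₁ + i y₁`, `z₂ = x₂ + i y₂`). -/
def measure : Measure Bicomplex :=
  (4 : ℝ≥0∞)⁻¹ • Measure.map (fun p : ℂ × ℂ => (⟨p.1, p.2⟩ : Bicomplex)) volume

/-- The bicomplex scalar product `⟨f, g⟩ = ∫ f g* dm` of `L²_BC(X, m)`. -/
def scalarProduct {X : Type*} [MeasurableSpace X] (m : Measure X) (f g : X → Bicomplex) :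
    Bicomplex :=
  ∫ x, f x * conj (g x) ∂m

/-- The hyperbolic number `X_e = x₁ e₊ + x₂ e₋`. -/
def Xe (Z : Bicomplex) : Bicomplex := Z.re.re • ePlus + Z.im.re • eMinus

/-- The hyperbolic number `Y_e = y₁ e₊ + y₂ e₋`. -/
def Ye (Z : Bicomplex) : Bicomplex := Z.re.im • ePlus + Z.im.im • eMinus

/-- The conjugation `Z† = z₁ - j z₂`; it exchanges `e₊` and `e₋`. -/
def dagger (Z : Bicomplex) : Bicomplex := ⟨Z.re, -Z.im⟩

/-- The translation `T_{X_e} ψ(t) = ψ⁺(t - x₁) e₊ + ψ⁻(t - x₂) e₋`. -/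
def translation (Z : Bicomplex) (ψ : ℝ → Bicomplex) (t : ℝ) : Bicomplex :=
  plus (ψ (t - Z.re.re)) • ePlus + minus (ψ (t - Z.im.re)) • eMinus

/-- The modulation
`M^{σ,ν,μ}_{X_e,Y_e} ψ(t) = exp(σ (ν e₊ + μ e₋) (t - X_e / 2) Y_e) ψ(t)`. -/
def modulation (σ : ℝ) (ν μ Z : Bicomplex) (ψ : ℝ → Bicomplex) (t : ℝ) : Bicomplex :=
  exp (σ • ((ν * ePlus + μ * eMinus) * (ofReal t - (1 / 2 : ℝ) • Xe Z) * Ye Z)) * ψ t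

/-- The integrand `φ(t) M^{σ,ν,μ}_{X_e,Y_e} (T_{X_e} ψ)*(t)`. -/
def fourierWignerIntegrand (σ : ℝ) (ν μ : Bicomplex) (φ ψ : ℝ → Bicomplex) (Z : Bicomplex)
    (t : ℝ) : Bicomplex :=
  φ t * modulation σ ν μ Z (fun s => conj (translation Z ψ s)) t

/-- The unidimensional bicomplex Fourier–Wigner transform. -/
def fourierWigner (σ : ℝ) (ν μ : Bicomplex) (φ ψ : ℝ → Bicomplex) (Z : Bicomplex) : Bicomplex :=
  (σ / Real.pi) • (exp (-((σ / 4) • (dagger (Xe Z) ^ 2 + dagger (Ye Z) ^ 2))) *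
    ∫ t : ℝ, fourierWignerIntegrand σ ν μ φ ψ Z t)

/-- The rescaled Hermite function
`h_n^σ(t) = (-1)^n e^{σ t² / 2} (d/dt)^n e^{-σ t²}`. -/
def hermiteFunction (σ : ℝ) (n : ℕ) (t : ℝ) : ℝ :=
  (-1) ^ n * Real.exp (σ / 2 * t ^ 2) * iteratedDeriv n (fun s : ℝ => Real.exp (-σ * s ^ 2)) t

/-- The Hermite function `h_n^σ` as a bicomplex-valued window. -/
def hermiteWindow (σ : ℝ) (n : ℕ) (t : ℝ) : Bicomplex := ofReal (hermiteFunction σ n t)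

/-- `S_n f = (σ/π)^{1/4} (2^n σ^n n!)^{-1/2} V(f, h_n^σ)`. -/
def hermiteTransform (σ : ℝ) (ν μ : Bicomplex) (n : ℕ) (f : ℝ → Bicomplex) (Z : Bicomplex) :
    Bicomplex :=
  ((σ / Real.pi) ^ (1 / 4 : ℝ) / Real.sqrt (2 ^ n * σ ^ n * (n.factorial : ℝ))) •
    fourierWigner σ ν μ f (hermiteWindow σ n) Z

/-- The Wirtinger derivative `∂F/∂z̄ = ½ (∂ₓ F + i ∂_y F)`. -/
def dbar (F : ℂ → ℂ) (z : ℂ) : ℂ :=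
  (1 / 2) * (fderiv ℝ F z 1 + Complex.I * fderiv ℝ F z Complex.I)

/-- The poly-Fock space of order `k` and weight `e^{-α|z|²}`: square integrable polyanalytic
functions of order `k`, that is, solutions of `∂^k F / ∂z̄^k = 0`. -/
def polyFock (α : ℝ) (k : ℕ) : Set (ℂ → ℂ) :=
  {F | ContDiff ℝ ∞ F ∧ (∀ z, (dbar^[k] F) z = 0) ∧
    Integrable (fun z => ‖F z‖ ^ 2 * Real.exp (-α * ‖z‖ ^ 2))}

/-- The true-poly-Fock space of level `n`: the orthogonal complement of the poly-Fock space of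
order `n` in the poly-Fock space of order `n + 1`. Level `0` is the Bargmann–Fock space. -/
def truePolyFock (α : ℝ) (n : ℕ) : Set (ℂ → ℂ) :=
  {F | F ∈ polyFock α (n + 1) ∧ ∀ G ∈ polyFock α n,
    ∫ z : ℂ, F z * (starRingEnd ℂ) (G z) * (Real.exp (-α * ‖z‖ ^ 2) : ℂ) = 0}

/-- The companion `Z^e = (x₁ + ν y₁) e₊ + (x₂ + μ y₂) e₋` of `Z`. -/
def companion (ν μ Z : Bicomplex) : Bicomplex :=
  (ofReal Z.re.re + ν * ofReal Z.re.im) * ePlus + (ofReal Z.im.re + μ * ofReal Z.im.im) * eMinus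

/-- The space of all `Z ↦ e^{-(σ/2)|Z^e|²} (F(z_{1ν}) e₊ + G(z_{2μ}) e₋)` with `F`, `G`
true-poly-Fock functions of level `n` for the weight `e^{-(σ/2)|z|²}`. The variables
`z_{1ν} = x₁ + ν y₁` and `z_{2μ} = x₂ + μ y₂` enter through their actions on `e₊` and on `e₋`,
that is, through the complex numbers `(Z^e)⁺` and `(Z^e)⁻`. -/
def trueCompanionSpace (σ : ℝ) (ν μ : Bicomplex) (n : ℕ) : Set (Bicomplex → Bicomplex) :=
  {Υ | ∃ F ∈ truePolyFock (σ / 2) n, ∃ G ∈ truePolyFock (σ / 2) n, ∀ Z,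
    Υ Z = Real.exp (-(σ / 2) * ‖companion ν μ Z‖ ^ 2) •
      (F (plus (companion ν μ Z)) • ePlus + G (minus (companion ν μ Z)) • eMinus)}

end Bicomplex

end

/-! The idempotents `ePlus`, `eMinus` decouple the problem. In each component the integral defining
the transform becomes a scalar short-time Fourier transform with window `h_n^σ`, evaluated at a
point twisted by a square root of -1, that is, at `z` or at its conjugate. The prefactor, because of
the dagger, supplies the Gaussian weight in the other variable. Hence `hermiteTransform_eq`: the
transform is `pairFun` of two scalar transforms `bargmann σ n`, composed with a measure preserving
change of variables. It remains to show that `bargmann σ n` maps `L²(ℝ)` onto the true-poly-Fock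
space of level `n` and multiplies scalar products by a constant, which the normalization absorbs
(`hermiteConst_sq_mul`).

Two facts carry the scalar statement. A Taylor expansion of the Hermite polynomial shows that
`bargmann σ n φ` is a polynomial of degree at most `n` in `z̄` with entire coefficients
(`bargmann_eq_sum`). Moyal's identity (`integral_waveTransform_mul_conj`) follows from Parseval in
`y` for fixed `x` and Fubini in `x`; orthogonality of the Hermite functions then makes distinct
levels orthogonal.

Surjectivity rests on `isBargmannSum_of_mem_polyFock`: the poly-Fock space of order `N` is the sum
of the images of levels below `N`. Subtracting from `G` its projections onto these images leaves a
polyanalytic remainder orthogonal to all of them, hence to every `z^a z̄^b` with `b < N`, since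
these monomials are themselves sums of Bargmann transforms (`isBargmannSum_monomial`). Such a
remainder is zero (`eq_zero_of_orthogonal_monomials`): each of its angular modes is a combination of
these monomials, and its product with its own mode is the squared norm of that mode. In the order `n
+ 1` space, orthogonality to order `n` then leaves the top level alone.

Closedness follows because the target is the range of an isometry defined on a complete space. -/

open MeasureTheory
open scoped ContDiff ENNReal

noncomputable section

namespace Bicomplex

/-! ### Hermite polynomials and Hermite functions -/

open Polynomial in
/-- The polynomials `P_n` with `h_n^σ(t) = P_n(t) e^{-σ t² / 2}`. -/
def hermitePoly (σ : ℝ) : ℕ → ℂ[X]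
  | 0 => 1
  | n + 1 => C (2 * σ : ℂ) * X * hermitePoly σ n - derivative (hermitePoly σ n)

-- The Appell property up to scaling, which makes Taylor expansions of Hermite polynomials close up
-- on Hermite polynomials. The truncated index at `n = 0` is harmless, since the factor `n` vanishes
-- there.
open Polynomial in
theorem derivative_hermitePoly (σ : ℝ) (n : ℕ) :
    derivative (hermitePoly σ n) = C (2 * σ * n : ℂ) * hermitePoly σ (n - 1) := by
  induction n with
  | zero => simp [hermitePoly]
  | succ n ih =>
    rcases n with _ | n
    · simp [hermitePoly]
    · have h2 : derivative (derivative (hermitePoly σ (n + 1))) =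
          C (2 * σ * (n + 1 : ℕ) : ℂ) * derivative (hermitePoly σ n) := by
        rw [ih]; simp
      rw [hermitePoly, derivative_sub, h2, derivative_mul, ih]
      simp only [derivative_mul, derivative_C, derivative_X, Nat.add_sub_cancel]
      have : hermitePoly σ (n + 1) =
        C (2 * σ : ℂ) * X * hermitePoly σ n - derivative (hermitePoly σ n) := rfl
      rw [this]
      simp only [map_mul, Nat.cast_add, Nat.cast_one, map_add, map_one]
      ring

theorem hermiteFunction_eq (σ : ℝ) (n : ℕ) (t : ℝ) :
    (hermiteFunction σ n t : ℂ) =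
      (hermitePoly σ n).eval (t : ℂ) * Complex.exp (-(σ / 2) * t ^ 2) := by
  have key : ∀ n : ℕ, ∀ t : ℝ,
      ((iteratedDeriv n (fun s : ℝ => Real.exp (-σ * s ^ 2)) t : ℝ) : ℂ) =
        (-1) ^ n * (hermitePoly σ n).eval (t : ℂ) * Complex.exp (-σ * t ^ 2) := by
    intro n
    induction n with
    | zero => intro t; simp [hermitePoly]
    | succ n ih =>
      intro t
      have hd : DifferentiableAt ℝ (iteratedDeriv n (fun s : ℝ => Real.exp (-σ * s ^ 2))) t := by
        have : ContDiff ℝ ∞ (fun s : ℝ => Real.exp (-σ * s ^ 2)) := by fun_prop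
        exact (this.differentiable_iteratedDeriv n (by exact_mod_cast WithTop.coe_lt_top _)) t
      rw [iteratedDeriv_succ]
      have h1 := hd.hasDerivAt.ofReal_comp
      have h2 : HasDerivAt (fun t : ℝ =>
          (-1) ^ n * (hermitePoly σ n).eval (t : ℂ) * Complex.exp (-σ * (t : ℂ) ^ 2))
          ((-1) ^ n * ((hermitePoly σ n).derivative.eval (t : ℂ)) * Complex.exp (-σ * (t : ℂ) ^ 2) +
            (-1) ^ n * (hermitePoly σ n).eval (t : ℂ) *
              (Complex.exp (-σ * (t : ℂ) ^ 2) * (-σ * (2 * (t : ℂ))))) t := by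
        have e1 := (((hermitePoly σ n).hasDerivAt (t : ℂ)).comp_ofReal).const_mul ((-1 : ℂ) ^ n)
        have e2 : HasDerivAt (fun z : ℂ => Complex.exp (-σ * z ^ 2))
            (Complex.exp (-σ * (t : ℂ) ^ 2) * (-σ * (2 * (t : ℂ)))) (t : ℂ) := by
          have := ((hasDerivAt_pow 2 (t : ℂ)).const_mul (-σ : ℂ)).cexp
          simpa using this
        exact e1.mul e2.comp_ofReal
      have h3 := h1.unique (h2.congr_of_eventuallyEq (Filter.Eventually.of_forall fun s => ih s))
      rw [h3, hermitePoly]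
      simp only [Polynomial.eval_sub, Polynomial.eval_mul, Polynomial.eval_C, Polynomial.eval_X]
      ring
  unfold hermiteFunction
  push_cast
  rw [key]
  have hexp : Complex.exp (σ / 2 * t ^ 2) * Complex.exp (-σ * t ^ 2) =
      Complex.exp (-(σ / 2) * t ^ 2) := by
    rw [← Complex.exp_add]; congr 1; ring
  have hsgn : ((-1 : ℂ) ^ n) * (-1) ^ n = 1 := by rw [← mul_pow]; simp
  rw [← hexp]
  linear_combination ((hermitePoly σ n).eval (t : ℂ) * Complex.exp (σ / 2 * t ^ 2) *
    Complex.exp (-σ * t ^ 2)) * hsgn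

open Polynomial in
theorem iterate_derivative_hermitePoly (σ : ℝ) (n k : ℕ) :
    derivative^[k] (hermitePoly σ n) =
      C ((2 * σ) ^ k * (n.descFactorial k : ℂ)) * hermitePoly σ (n - k) := by
  induction k with
  | zero => simp
  | succ k ih =>
    rw [Function.iterate_succ_apply', ih, derivative_C_mul, derivative_hermitePoly,
      ← mul_assoc, ← C_mul, Nat.descFactorial_succ, Nat.sub_sub]
    congr 2
    push_cast
    ring

open Polynomial in
theorem natDegree_hermitePoly_le (σ : ℝ) (n : ℕ) : (hermitePoly σ n).natDegree ≤ n := by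
  induction n with
  | zero => simp [hermitePoly]
  | succ n ih =>
    refine (natDegree_sub_le _ _).trans (max_le ?_ ?_)
    · refine natDegree_mul_le.trans ?_
      have : (C (2 * σ : ℂ) * X).natDegree ≤ 1 := (natDegree_C_mul_le _ _).trans natDegree_X_le
      omega
    · exact (natDegree_derivative_le _).trans (by omega)

-- Taylor's formula at `a`, all of whose derivatives are again Hermite polynomials. It will separate
-- `z̄` (through `b`) from the holomorphic variable (through `a`).
open Polynomial in
theorem eval_add_hermitePoly (σ : ℝ) (n : ℕ) (a b : ℂ) :
    (hermitePoly σ n).eval (a + b) = ∑ k ∈ Finset.range (n + 1),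
      (n.choose k : ℂ) * (2 * σ * b) ^ k * (hermitePoly σ (n - k)).eval a := by
  rw [add_comm a b, ← taylor_eval, eval_eq_sum_range' (n := n + 1)]
  · refine Finset.sum_congr rfl fun k _ => ?_
    rw [taylor_coeff]
    -- The Hasse derivative is the `k`-th derivative divided by `k!`, and the falling factorial is
    -- `k!` times the binomial coefficient; `k!` is cancelled below.
    have h : (k.factorial : ℂ) * eval a (hasseDeriv k (hermitePoly σ n)) =
        (2 * σ) ^ k * (k.factorial * n.choose k : ℂ) * eval a (hermitePoly σ (n - k)) := by
      have h1 := congrFun (factorial_smul_hasseDeriv (R := ℂ) k) (hermitePoly σ n)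
      rw [LinearMap.smul_apply, iterate_derivative_hermitePoly,
        Nat.descFactorial_eq_factorial_mul_choose] at h1
      have h2 := congrArg (eval a) h1
      rw [eval_smul, nsmul_eq_mul, eval_mul, eval_C] at h2
      exact_mod_cast h2
    have hk : (k.factorial : ℂ) ≠ 0 := Nat.cast_ne_zero.2 k.factorial_ne_zero
    have h' : eval a (hasseDeriv k (hermitePoly σ n)) =
      (2 * σ) ^ k * (n.choose k : ℂ) * eval a (hermitePoly σ (n - k)) := by
      apply mul_left_cancel₀ hk
      linear_combination h
    rw [h', mul_pow]
    ring
  · rw [natDegree_taylor]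
    exact Nat.lt_succ_of_le (natDegree_hermitePoly_le σ n)

/-- A polynomial grows at most exponentially. -/
theorem exists_norm_eval_le_exp (Q : Polynomial ℂ) :
    ∃ C : ℝ, 0 ≤ C ∧ ∀ w : ℂ, ‖Q.eval w‖ ≤ C * Real.exp ‖w‖ := by
  induction Q using Polynomial.induction_on' with
  | add p q hp hq =>
    obtain ⟨A, hA, hp⟩ := hp
    obtain ⟨B, hB, hq⟩ := hq
    refine ⟨A + B, add_nonneg hA hB, fun w => ?_⟩
    rw [Polynomial.eval_add, add_mul]
    exact (norm_add_le _ _).trans (add_le_add (hp w) (hq w))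
  | monomial n a =>
    refine ⟨‖a‖ * n.factorial, by positivity, fun w => ?_⟩
    rw [Polynomial.eval_monomial, norm_mul, norm_pow, mul_assoc]
    gcongr
    have := Real.pow_div_factorial_le_exp ‖w‖ (norm_nonneg _) n
    rwa [div_le_iff₀ (by positivity), mul_comm] at this

/-- Completing the square: half of the Gaussian decay pays for any exponential growth, and so for
any polynomial factor. -/
theorem exp_linear_gaussian_le (σ : ℝ) (hσ : 0 < σ) (b t : ℝ) :
    Real.exp (-(σ / 2) * t ^ 2 + b * |t|) ≤
      Real.exp (b ^ 2 / σ) * Real.exp (-(σ / 4) * t ^ 2) := by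
  rw [← Real.exp_add, Real.exp_le_exp]
  have h := sq_nonneg (σ * |t| / 2 - b)
  have : (σ * |t| / 2 - b) ^ 2 / σ = σ / 4 * t ^ 2 - b * |t| + b ^ 2 / σ := by
    field_simp
    rw [← sq_abs t]
    ring
  have h2 := div_nonneg h hσ.le
  linarith

theorem exists_abs_hermiteFunction_le (σ : ℝ) (hσ : 0 < σ) (n : ℕ) :
    ∃ C : ℝ, 0 ≤ C ∧ ∀ t, |hermiteFunction σ n t| ≤ C * Real.exp (-(σ / 4) * t ^ 2) := by
  obtain ⟨C, hC, h⟩ := exists_norm_eval_le_exp (hermitePoly σ n)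
  refine ⟨C * Real.exp (1 ^ 2 / σ), by positivity, fun t => ?_⟩
  have h0 : |hermiteFunction σ n t| = ‖(hermiteFunction σ n t : ℂ)‖ := by simp
  have he : ‖Complex.exp (-(σ / 2) * t ^ 2)‖ = Real.exp (-(σ / 2) * t ^ 2) := by
    rw [Complex.norm_exp]; congr 1; norm_cast
  rw [h0, hermiteFunction_eq, norm_mul, he, mul_assoc]
  calc _ ≤ C * Real.exp ‖(t : ℂ)‖ * Real.exp (-(σ / 2) * t ^ 2) := by gcongr; exact h _
    _ = C * Real.exp (-(σ / 2) * t ^ 2 + 1 * |t|) := by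
      rw [mul_assoc, ← Real.exp_add, Complex.norm_real, Real.norm_eq_abs]; ring_nf
    _ ≤ _ := by gcongr; exact exp_linear_gaussian_le σ hσ 1 t

theorem contDiff_hermiteFunction (σ : ℝ) (n : ℕ) : ContDiff ℝ ∞ (hermiteFunction σ n) := by
  have : ContDiff ℝ ∞ (fun s : ℝ => Real.exp (-σ * s ^ 2)) := by fun_prop
  unfold hermiteFunction
  have h2 : ContDiff ℝ ∞ (iteratedDeriv n (fun s : ℝ => Real.exp (-σ * s ^ 2))) := by
    rw [iteratedDeriv_eq_iterate]
    exact ContDiff.iterate_deriv n this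
  fun_prop

theorem continuous_hermiteFunction (σ : ℝ) (n : ℕ) : Continuous (hermiteFunction σ n) :=
  (contDiff_hermiteFunction σ n).continuous

theorem hasDerivAt_hermiteFunction (σ : ℝ) (n : ℕ) (t : ℝ) :
    HasDerivAt (hermiteFunction σ n) (σ * t * hermiteFunction σ n t - hermiteFunction σ (n + 1) t)
      t := by
  have hd := ((contDiff_hermiteFunction σ n).differentiable (by simp) t).hasDerivAt
  have h1 := hd.ofReal_comp
  have e1 := ((hermitePoly σ n).hasDerivAt (t : ℂ)).comp_ofReal
  have e2 : HasDerivAt (fun z : ℂ => Complex.exp (-(σ / 2) * z ^ 2))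
      (Complex.exp (-(σ / 2) * (t : ℂ) ^ 2) * (-(σ / 2) * (2 * (t : ℂ)))) (t : ℂ) := by
    have := ((hasDerivAt_pow 2 (t : ℂ)).const_mul (-(σ / 2) : ℂ)).cexp
    simpa using this
  have h3 := h1.unique ((e1.mul e2.comp_ofReal).congr_of_eventuallyEq
    (Filter.Eventually.of_forall fun s => hermiteFunction_eq σ n s))
  have h4 : deriv (hermiteFunction σ n) t =
      σ * t * hermiteFunction σ n t - hermiteFunction σ (n + 1) t := by
    have : ((deriv (hermiteFunction σ n) t : ℝ) : ℂ) =
        ((σ * t * hermiteFunction σ n t - hermiteFunction σ (n + 1) t : ℝ) : ℂ) := by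
      rw [h3]
      push_cast
      rw [hermiteFunction_eq, hermiteFunction_eq, hermitePoly]
      simp only [Polynomial.eval_sub, Polynomial.eval_mul, Polynomial.eval_C, Polynomial.eval_X]
      ring
    exact_mod_cast this
  rwa [h4] at hd

theorem hermiteFunction_succ_add (σ : ℝ) (n : ℕ) (t : ℝ) :
    hermiteFunction σ (n + 1) t + 2 * σ * n * hermiteFunction σ (n - 1) t =
      2 * σ * t * hermiteFunction σ n t := by
  have : ((hermiteFunction σ (n + 1) t + 2 * σ * n * hermiteFunction σ (n - 1) t : ℝ) : ℂ) =
      ((2 * σ * t * hermiteFunction σ n t : ℝ) : ℂ) := by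
    push_cast
    rw [hermiteFunction_eq, hermiteFunction_eq, hermiteFunction_eq, hermitePoly,
      derivative_hermitePoly]
    simp only [Polynomial.eval_sub, Polynomial.eval_mul, Polynomial.eval_C, Polynomial.eval_X]
    ring
  exact_mod_cast this

theorem integrable_hermiteFunction_mul (σ : ℝ) (hσ : 0 < σ) (j k : ℕ) :
    Integrable (fun t => hermiteFunction σ j t * hermiteFunction σ k t) := by
  obtain ⟨A, hA, ha⟩ := exists_abs_hermiteFunction_le σ hσ j
  obtain ⟨B, hB, hb⟩ := exists_abs_hermiteFunction_le σ hσ k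
  have hg : Integrable (fun t : ℝ => A * B * Real.exp (-(σ / 2) * t ^ 2)) :=
    (integrable_exp_neg_mul_sq (half_pos hσ)).const_mul _
  refine hg.mono' ((continuous_hermiteFunction σ j).mul
    (continuous_hermiteFunction σ k)).aestronglyMeasurable (Filter.Eventually.of_forall fun t => ?_)
  rw [norm_mul, Real.norm_eq_abs, Real.norm_eq_abs]
  calc _ ≤ (A * Real.exp (-(σ / 4) * t ^ 2)) * (B * Real.exp (-(σ / 4) * t ^ 2)) := by
        gcongr
        · exact ha t
        · exact hb t
    _ = A * B * (Real.exp (-(σ / 4) * t ^ 2) * Real.exp (-(σ / 4) * t ^ 2)) := by ring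
    _ = _ := by rw [← Real.exp_add]; ring_nf

/-- Integration by parts: the raising operator `σt - d/dt` is adjoint to the lowering operator `σt +
d/dt`, and the latter sends `h_j` to `2σj h_{j-1}`. -/
theorem integral_hermiteFunction_succ (σ : ℝ) (hσ : 0 < σ) (j k : ℕ) :
    ∫ t, hermiteFunction σ j t * hermiteFunction σ (k + 1) t =
      2 * σ * j * ∫ t, hermiteFunction σ (j - 1) t * hermiteFunction σ k t := by
  -- The three-term recurrence removes the factor `t`, so that every integrability condition
  -- concerns products of two Hermite functions.
  have e : ∀ t, σ * t * hermiteFunction σ j t - hermiteFunction σ (j + 1) t =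
      σ * j * hermiteFunction σ (j - 1) t - (1 / 2) * hermiteFunction σ (j + 1) t := fun t => by
    linear_combination -(1 / 2) * hermiteFunction_succ_add σ j t
  have e' : ∀ t, σ * t * hermiteFunction σ k t - hermiteFunction σ (k + 1) t =
      σ * k * hermiteFunction σ (k - 1) t - (1 / 2) * hermiteFunction σ (k + 1) t := fun t => by
    linear_combination -(1 / 2) * hermiteFunction_succ_add σ k t
  have I := integrable_hermiteFunction_mul σ hσ
  have h := integral_mul_deriv_eq_deriv_mul_of_integrable
    (fun t _ => hasDerivAt_hermiteFunction σ j t) (fun t _ => hasDerivAt_hermiteFunction σ k t) ?_ ?_ (I j k)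
  · have h2 : (∫ t, (hermiteFunction σ j t * hermiteFunction σ (k + 1) t -
        2 * σ * j * (hermiteFunction σ (j - 1) t * hermiteFunction σ k t))) = 0 := by
      rw [← integral_neg] at h
      have h3 := sub_eq_zero.2 h
      rw [← integral_sub] at h3
      · rw [← neg_eq_zero, ← integral_neg, ← h3]
        refine integral_congr_ae (Filter.Eventually.of_forall fun t => ?_)
        dsimp only
        linear_combination hermiteFunction σ k t * hermiteFunction_succ_add σ j t
      · have := ((I j (k - 1)).const_mul (σ * k)).sub ((I j (k + 1)).const_mul (1 / 2))
        refine this.congr (Filter.Eventually.of_forall fun t => ?_)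
        simp only [e', Pi.sub_apply]; ring
      · have := (((I (j - 1) k).const_mul (σ * j)).sub ((I (j + 1) k).const_mul (1 / 2))).neg
        refine this.congr (Filter.Eventually.of_forall fun t => ?_)
        simp only [e, Pi.sub_apply, Pi.neg_apply]; ring
    rw [integral_sub (I _ _) ((I _ _).const_mul _), integral_const_mul] at h2
    linarith
  · have := ((I j (k - 1)).const_mul (σ * k)).sub ((I j (k + 1)).const_mul (1 / 2))
    refine this.congr (Filter.Eventually.of_forall fun t => ?_)
    simp only [e', Pi.sub_apply, Pi.mul_apply]; ring
  · have := ((I (j - 1) k).const_mul (σ * j)).sub ((I (j + 1) k).const_mul (1 / 2))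
    refine this.congr (Filter.Eventually.of_forall fun t => ?_)
    simp only [e, Pi.sub_apply, Pi.mul_apply]; ring

theorem integral_hermiteFunction_mul_of_lt (σ : ℝ) (hσ : 0 < σ) (j k : ℕ) (h : j < k) :
    ∫ t, hermiteFunction σ j t * hermiteFunction σ k t = 0 := by
  induction j generalizing k with
  | zero =>
    obtain ⟨k, rfl⟩ : ∃ m, k = m + 1 := ⟨k - 1, by omega⟩
    -- Both indices have been lowered until the smaller one is 0, where the factor `j` kills the
    -- integral.
    rw [integral_hermiteFunction_succ σ hσ]; simp
  | succ j ih =>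
    obtain ⟨k, rfl⟩ : ∃ m, k = m + 1 := ⟨k - 1, by omega⟩
    rw [integral_hermiteFunction_succ σ hσ, Nat.add_sub_cancel, ih k (by omega), mul_zero]

theorem integral_hermiteFunction_mul_of_ne (σ : ℝ) (hσ : 0 < σ) (j k : ℕ) (h : j ≠ k) :
    ∫ t, hermiteFunction σ j t * hermiteFunction σ k t = 0 := by
  rcases h.lt_or_gt with h | h
  · exact integral_hermiteFunction_mul_of_lt σ hσ j k h
  · simp_rw [mul_comm (hermiteFunction σ j _)]
    exact integral_hermiteFunction_mul_of_lt σ hσ k j h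

theorem hermiteFunction_zero (σ : ℝ) (t : ℝ) :
    hermiteFunction σ 0 t = Real.exp (-(σ / 2) * t ^ 2) := by
  simp only [hermiteFunction, pow_zero, one_mul, iteratedDeriv_zero, ← Real.exp_add]
  ring_nf

theorem integral_hermiteFunction_mul_self (σ : ℝ) (hσ : 0 < σ) (n : ℕ) :
    ∫ t, hermiteFunction σ n t * hermiteFunction σ n t =
      2 ^ n * σ ^ n * n.factorial * Real.sqrt (Real.pi / σ) := by
  induction n with
  | zero =>
    simp_rw [hermiteFunction_zero, ← Real.exp_add, ← two_mul]
    rw [show (fun t : ℝ => Real.exp (2 * (-(σ / 2) * t ^ 2))) = fun t => Real.exp (-σ * t ^ 2) from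
      funext fun t => by ring_nf, integral_gaussian]
    simp
  | succ n ih =>
    rw [integral_hermiteFunction_succ σ hσ, Nat.add_sub_cancel, ih, Nat.factorial_succ]
    push_cast
    ring

/-! ### The Bargmann kernel and the Bargmann transforms -/

/-- The Bargmann kernel `e^{-σ t² / 2 + σ t z - σ z² / 4}`. -/
def bargmannKernel (σ : ℝ) (z : ℂ) (t : ℝ) : ℂ :=
  Complex.exp (-(σ / 2) * t ^ 2 + σ * t * z - σ / 4 * z ^ 2)

theorem continuous_bargmannKernel (σ : ℝ) (z : ℂ) : Continuous (bargmannKernel σ z) := by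
  unfold bargmannKernel; fun_prop

theorem norm_bargmannKernel_le (σ : ℝ) (hσ : 0 < σ) (R : ℝ) (z : ℂ) (hz : ‖z‖ ≤ R) (t : ℝ) :
    ‖bargmannKernel σ z t‖ ≤
      Real.exp (σ / 4 * R ^ 2) * Real.exp (-(σ / 2) * t ^ 2 + σ * R * |t|) := by
  rw [bargmannKernel, Complex.norm_exp, ← Real.exp_add, Real.exp_le_exp]
  have e : (-(σ / 2) * t ^ 2 + σ * t * z - σ / 4 * z ^ 2 : ℂ).re =
      -(σ / 2) * t ^ 2 + (σ * t * z : ℂ).re - (σ / 4 * z ^ 2 : ℂ).re := by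
    rw [Complex.sub_re, Complex.add_re]; norm_cast
  have h1 : (σ * t * z : ℂ).re ≤ σ * R * |t| := by
    refine (Complex.re_le_norm _).trans ?_
    rw [norm_mul, norm_mul, Complex.norm_real, Complex.norm_real, Real.norm_eq_abs,
      Real.norm_eq_abs, abs_of_pos hσ, mul_assoc, mul_assoc, mul_comm R]
    gcongr
  have h2 : -(σ / 4 * z ^ 2 : ℂ).re ≤ σ / 4 * R ^ 2 := by
    refine (neg_le_abs _).trans ((Complex.abs_re_le_norm _).trans ?_)
    rw [norm_mul, norm_pow, norm_div, Complex.norm_real, Real.norm_eq_abs, abs_of_pos hσ]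
    norm_num
    gcongr
  rw [e]
  linarith

/-- One Gaussian bound for all `z` in a disc, serving both for square integrability and for
differentiation under the integral. The condition on `w` is loose enough for the shifts `t - z/2`
and `t - Re z`. -/
theorem exists_norm_kernel_mul_eval_le (σ : ℝ) (hσ : 0 < σ) (R : ℝ) (Q : Polynomial ℂ) :
    ∃ C : ℝ, 0 ≤ C ∧ ∀ z : ℂ, ‖z‖ ≤ R → ∀ (t : ℝ) (w : ℂ), ‖w‖ ≤ |t| + R →
      ‖bargmannKernel σ z t * Q.eval w‖ ≤ C * Real.exp (-(σ / 4) * t ^ 2) := by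
  obtain ⟨C, hC, h⟩ := exists_norm_eval_le_exp Q
  refine ⟨C * Real.exp (σ / 4 * R ^ 2 + R) * Real.exp ((σ * R + 1) ^ 2 / σ), by positivity,
    fun z hz t w hw => ?_⟩
  rw [norm_mul]
  calc _ ≤ (Real.exp (σ / 4 * R ^ 2) * Real.exp (-(σ / 2) * t ^ 2 + σ * R * |t|)) *
        (C * Real.exp (|t| + R)) := by
        gcongr
        · exact norm_bargmannKernel_le σ hσ R z hz t
        · exact (h w).trans (by gcongr)
    _ = C * Real.exp (σ / 4 * R ^ 2 + R) *
        Real.exp (-(σ / 2) * t ^ 2 + (σ * R + 1) * |t|) := by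
        rw [show -(σ / 2) * t ^ 2 + (σ * R + 1) * |t| = (-(σ / 2) * t ^ 2 + σ * R * |t|) + |t| by
          ring]
        simp only [Real.exp_add]
        ring
    _ ≤ C * Real.exp (σ / 4 * R ^ 2 + R) *
        (Real.exp ((σ * R + 1) ^ 2 / σ) * Real.exp (-(σ / 4) * t ^ 2)) := by
        gcongr
        exact exp_linear_gaussian_le σ hσ _ t
    _ = _ := by ring

theorem memLp_two_gaussian (σ : ℝ) (hσ : 0 < σ) (C : ℝ) :
    MemLp (fun t : ℝ => C * Real.exp (-(σ / 4) * t ^ 2)) 2 := by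
  rw [memLp_two_iff_integrable_sq (by fun_prop)]
  have := (integrable_exp_neg_mul_sq (half_pos hσ)).const_mul (C ^ 2)
  refine this.congr (Filter.Eventually.of_forall fun t => ?_)
  simp only [mul_pow, ← Real.exp_nat_mul]
  congr 2; push_cast; ring

theorem memLp_two_of_le_gaussian (σ : ℝ) (hσ : 0 < σ) {g : ℝ → ℂ}
    (hg : Continuous g) {C : ℝ} (h : ∀ t, ‖g t‖ ≤ C * Real.exp (-(σ / 4) * t ^ 2)) :
    MemLp g 2 :=
  (memLp_two_gaussian σ hσ C).mono' hg.aestronglyMeasurable (Filter.Eventually.of_forall h)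

theorem integrable_mul_kernel_mul_eval (σ : ℝ) (hσ : 0 < σ) {φ : ℝ → ℂ} (hφ : MemLp φ 2)
    (Q : Polynomial ℂ) (z b : ℂ) :
    Integrable (fun t : ℝ => φ t * (bargmannKernel σ z t * Q.eval (t - b))) := by
  obtain ⟨C, hC, h⟩ := exists_norm_kernel_mul_eval_le σ hσ (max ‖z‖ ‖b‖) Q
  refine hφ.integrable_mul (memLp_two_of_le_gaussian σ hσ (C := C) ?_ fun t => ?_)
  · have := Q.continuous
    exact (continuous_bargmannKernel σ z).mul (this.comp (by fun_prop))
  · refine h z (le_max_left _ _) t _ ((norm_sub_le _ _).trans ?_)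
    rw [Complex.norm_real, Real.norm_eq_abs]
    gcongr
    exact le_max_right _ _

/-- The holomorphic building blocks `∫ φ(t) e^{-σt²/2 + σtz - σz²/4} P_j(t - z/2) dt`. -/
def bargmannHolo (σ : ℝ) (j : ℕ) (φ : ℝ → ℂ) (z : ℂ) : ℂ :=
  ∫ t : ℝ, φ t * (bargmannKernel σ z t * (hermitePoly σ j).eval (t - z / 2))

/-- The Bargmann transform of level `n`. -/
def bargmann (σ : ℝ) (n : ℕ) (φ : ℝ → ℂ) (z : ℂ) : ℂ :=
  ∫ t : ℝ, φ t * (bargmannKernel σ z t * (hermitePoly σ n).eval (t - (z.re : ℂ)))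

/-- With `u = t - z/2`, the kernel contributes `σu` and the polynomial `-P_j'(u)/2`; together `σuP_j
- P_j'/2 = P_{j+1}/2` by the recursion. So differentiation in `z` raises the index. -/
theorem hasDerivAt_bargmannHolo (σ : ℝ) (hσ : 0 < σ) (j : ℕ) {φ : ℝ → ℂ} (hφ : MemLp φ 2)
    (z : ℂ) : HasDerivAt (bargmannHolo σ j φ) (1 / 2 * bargmannHolo σ (j + 1) φ z) z := by
  obtain ⟨C, hC, h⟩ := exists_norm_kernel_mul_eval_le σ hσ (‖z‖ + 1) (hermitePoly σ (j + 1))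
  have hm : ∀ w : ℂ, AEStronglyMeasurable
      (fun t : ℝ => φ t * (bargmannKernel σ w t * (hermitePoly σ j).eval (t - w / 2))) volume :=
    fun w => (integrable_mul_kernel_mul_eval σ hσ hφ _ w (w / 2)).aestronglyMeasurable
  have key := hasDerivAt_integral_of_dominated_loc_of_deriv_le (μ := (volume : Measure ℝ))
    (F := fun w t => φ t * (bargmannKernel σ w t * (hermitePoly σ j).eval (t - w / 2)))
    (F' := fun w t =>
      (1 / 2) * (φ t * (bargmannKernel σ w t * (hermitePoly σ (j + 1)).eval (t - w / 2))))
    (bound := fun t => (1 / 2) * (‖φ t‖ * (C * Real.exp (-(σ / 4) * t ^ 2))))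
    (Metric.ball_mem_nhds z one_pos) (Filter.Eventually.of_forall hm)
    (integrable_mul_kernel_mul_eval σ hσ hφ _ z (z / 2))
    ((integrable_mul_kernel_mul_eval σ hσ hφ _ z (z / 2)).const_mul _).aestronglyMeasurable
    (Filter.Eventually.of_forall fun t w hw => ?_)
    ((hφ.norm.integrable_mul (memLp_two_gaussian σ hσ C)).const_mul _)
    (Filter.Eventually.of_forall fun t w _ => ?_)
  · have h2 := key.2
    rw [integral_const_mul] at h2
    exact h2
  · have hw' : ‖w‖ ≤ ‖z‖ + 1 := by
      have := norm_le_norm_add_norm_sub' w z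
      rw [Metric.mem_ball, dist_eq_norm] at hw
      linarith
    rw [norm_mul, norm_mul]
    have : ‖(1 / 2 : ℂ)‖ = 1 / 2 := by simp
    rw [this]
    gcongr
    refine h w hw' t _ ((norm_sub_le _ _).trans ?_)
    rw [Complex.norm_real, Real.norm_eq_abs, norm_div]
    have : ‖w‖ / ‖(2 : ℂ)‖ ≤ ‖z‖ + 1 := by
      rw [Complex.norm_ofNat]
      linarith [norm_nonneg w]
    gcongr
  · have e1 : HasDerivAt (fun w : ℂ => bargmannKernel σ w t)
        (bargmannKernel σ w t * (σ * t - σ / 4 * (2 * w))) w := by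
      unfold bargmannKernel
      refine HasDerivAt.cexp ?_
      have := (((hasDerivAt_id w).const_mul (σ * t : ℂ)).const_add (-(σ / 2) * (t : ℂ) ^ 2)).sub
        ((hasDerivAt_pow 2 w).const_mul (σ / 4 : ℂ))
      simpa using! this
    have e2 : HasDerivAt (fun w : ℂ => (hermitePoly σ j).eval (t - w / 2))
        ((hermitePoly σ j).derivative.eval (t - w / 2) * (-(1 / 2))) w := by
      refine ((hermitePoly σ j).hasDerivAt _).comp w ?_
      exact ((hasDerivAt_id w).div_const 2).const_sub _
    refine ((e1.mul e2).const_mul (φ t)).congr_deriv ?_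
    rw [hermitePoly]
    simp only [Polynomial.eval_sub, Polynomial.eval_mul, Polynomial.eval_C, Polynomial.eval_X]
    ring

theorem differentiable_bargmannHolo (σ : ℝ) (hσ : 0 < σ) (j : ℕ) {φ : ℝ → ℂ} (hφ : MemLp φ 2) :
    Differentiable ℂ (bargmannHolo σ j φ) :=
  fun z => (hasDerivAt_bargmannHolo σ hσ j hφ z).differentiableAt

theorem bargmann_zero (σ : ℝ) (φ : ℝ → ℂ) : bargmann σ 0 φ = bargmannHolo σ 0 φ := by
  funext z
  simp [bargmann, bargmannHolo, hermitePoly]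

/-- Since `Re z = (z + z̄)/2`, one has `t - Re z = (t - z/2) - z̄/2`; expanding at `t - z/2` puts
all of `z̄` into powers of `-σz̄`. -/
theorem bargmann_eq_sum (σ : ℝ) (hσ : 0 < σ) (n : ℕ) {φ : ℝ → ℂ} (hφ : MemLp φ 2) (z : ℂ) :
    bargmann σ n φ z = ∑ k ∈ Finset.range (n + 1),
      (starRingEnd ℂ) z ^ k * ((n.choose k * (-σ) ^ k : ℂ) * bargmannHolo σ (n - k) φ z) := by
  have e : ∀ t : ℝ, φ t * (bargmannKernel σ z t * (hermitePoly σ n).eval (t - (z.re : ℂ))) =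
      ∑ k ∈ Finset.range (n + 1), ((starRingEnd ℂ) z ^ k * (n.choose k * (-σ) ^ k : ℂ)) *
        (φ t * (bargmannKernel σ z t * (hermitePoly σ (n - k)).eval (t - z / 2))) := by
    intro t
    have hz : (t : ℂ) - (z.re : ℂ) = (t - z / 2) + (-((starRingEnd ℂ) z) / 2) := by
      rw [Complex.re_eq_add_conj]; ring
    rw [hz, eval_add_hermitePoly, Finset.mul_sum, Finset.mul_sum]
    refine Finset.sum_congr rfl fun k _ => ?_
    rw [show (2 * σ * (-(starRingEnd ℂ) z / 2) : ℂ) = (starRingEnd ℂ) z * -σ by ring, mul_pow]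
    ring
  unfold bargmann bargmannHolo
  simp_rw [e]
  rw [integral_finsetSum]
  · refine Finset.sum_congr rfl fun k _ => ?_
    rw [integral_const_mul]
    ring
  · intro k _
    exact (integrable_mul_kernel_mul_eval σ hσ hφ _ z (z / 2)).const_mul _

/-- Completing the square in the exponent: up to the growth factor `e^{σ|z|²/4}`, the kernel is the
translated and modulated Hermite function. -/
theorem kernel_mul_eval_eq (σ : ℝ) (n : ℕ) (z : ℂ) (t : ℝ) :
    bargmannKernel σ z t * (hermitePoly σ n).eval (t - (z.re : ℂ)) =
      Real.exp (σ / 4 * ‖z‖ ^ 2) * (Complex.exp (Complex.I * σ * (t - z.re / 2) * z.im) *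
        hermiteFunction σ n (t - z.re)) := by
  rw [hermiteFunction_eq, bargmannKernel, ← Complex.normSq_eq_norm_sq, Complex.normSq_apply]
  push_cast
  have : Complex.exp (-(σ / 2) * t ^ 2 + σ * t * z - σ / 4 * z ^ 2) =
      Complex.exp (σ / 4 * (z.re * z.re + z.im * z.im)) *
        (Complex.exp (Complex.I * σ * (t - z.re / 2) * z.im) *
          Complex.exp (-(σ / 2) * (t - z.re) ^ 2)) := by
    rw [← Complex.exp_add, ← Complex.exp_add]
    congr 1
    have hz := Complex.re_add_im z
    linear_combination -(σ * t - σ / 4 * (z + z.re + z.im * Complex.I)) * hz -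
      σ / 4 * z.im ^ 2 * Complex.I_sq
  rw [this]
  ring

theorem memLp_hermiteFunction (σ : ℝ) (hσ : 0 < σ) (n : ℕ) :
    MemLp (fun t => (hermiteFunction σ n t : ℂ)) 2 := by
  obtain ⟨C, -, h⟩ := exists_abs_hermiteFunction_le σ hσ n
  refine memLp_two_of_le_gaussian σ hσ (C := C)
    (Complex.continuous_ofReal.comp (continuous_hermiteFunction σ n)) fun t => ?_
  rw [Complex.norm_real]
  exact h t

/-- The integral of the total derivative of `h_m` times the kernel is zero: under the transform of
level 0, raising the Hermite index becomes multiplication by `σz`. -/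
theorem bargmann_zero_hermiteFunction_succ (σ : ℝ) (hσ : 0 < σ) (m : ℕ) (z : ℂ) :
    bargmann σ 0 (fun t => (hermiteFunction σ (m + 1) t : ℂ)) z =
      σ * z * bargmann σ 0 (fun t => (hermiteFunction σ m t : ℂ)) z := by
  have hint : ∀ m, Integrable (fun t : ℝ => (hermiteFunction σ m t : ℂ) * bargmannKernel σ z t) :=
    fun m => by
      simpa using integrable_mul_kernel_mul_eval σ hσ (memLp_hermiteFunction σ hσ m) 1 z 0
  have hb : ∀ m, bargmann σ 0 (fun t => (hermiteFunction σ m t : ℂ)) z =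
      ∫ t : ℝ, (hermiteFunction σ m t : ℂ) * bargmannKernel σ z t := fun m => by
    simp [bargmann, hermitePoly]
  have hd : ∀ t : ℝ, HasDerivAt (fun t : ℝ => (hermiteFunction σ m t : ℂ) * bargmannKernel σ z t)
      (σ * z * ((hermiteFunction σ m t : ℂ) * bargmannKernel σ z t) -
        (hermiteFunction σ (m + 1) t : ℂ) * bargmannKernel σ z t) t := by
    intro t
    have e1 := (hasDerivAt_hermiteFunction σ m t).ofReal_comp
    have e2 : HasDerivAt (bargmannKernel σ z)
        (bargmannKernel σ z t * (-(σ / 2) * (2 * t) + σ * z)) t := by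
      have : HasDerivAt (fun w : ℂ => Complex.exp (-(σ / 2) * w ^ 2 + σ * w * z - σ / 4 * z ^ 2))
          (Complex.exp (-(σ / 2) * (t : ℂ) ^ 2 + σ * t * z - σ / 4 * z ^ 2) *
            (-(σ / 2) * (2 * t) + σ * z)) (t : ℂ) := by
        refine HasDerivAt.cexp (HasDerivAt.sub_const _ ?_)
        have := ((hasDerivAt_pow 2 (t : ℂ)).const_mul (-(σ / 2) : ℂ)).add
          (((hasDerivAt_id (t : ℂ)).const_mul (σ : ℂ)).mul_const z)
        simpa using! this
      exact this.comp_ofReal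
    refine (e1.mul e2).congr_deriv ?_
    push_cast
    ring
  have h0 := integral_eq_zero_of_hasDerivAt_of_integrable hd
    (((hint m).const_mul _).sub (hint (m + 1))) (hint m)
  rw [integral_sub ((hint m).const_mul _) (hint (m + 1)), integral_const_mul] at h0
  rw [hb, hb]
  linear_combination -h0

theorem bargmann_zero_hermiteFunction (σ : ℝ) (hσ : 0 < σ) (m : ℕ) (z : ℂ) :
    bargmann σ 0 (fun t => (hermiteFunction σ m t : ℂ)) z =
      (Real.pi / σ : ℂ) ^ (1 / 2 : ℂ) * (σ * z) ^ m := by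
  induction m with
  | zero =>
    simp only [bargmann, hermitePoly, Polynomial.eval_one, mul_one, pow_zero, bargmannKernel]
    have : ∀ t : ℝ, (hermiteFunction σ 0 t : ℂ) *
        Complex.exp (-(σ / 2) * t ^ 2 + σ * t * z - σ / 4 * z ^ 2) =
        Complex.exp (-σ * t ^ 2 + (σ * z) * t + -(σ / 4 * z ^ 2)) := by
      intro t
      rw [hermiteFunction_zero]
      push_cast
      rw [← Complex.exp_add]
      congr 1; ring
    simp_rw [this]
    rw [integral_cexp_quadratic (by simpa using hσ)]
    have h1 : (-(σ / 4 * z ^ 2) - (σ * z) ^ 2 / (4 * -σ) : ℂ) = 0 := by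
      have : (σ : ℂ) ≠ 0 := by exact_mod_cast hσ.ne'
      field_simp; ring
    rw [h1]; simp
  | succ m ih =>
    rw [bargmann_zero_hermiteFunction_succ σ hσ, ih]; ring

/-! ### Polyanalytic functions -/

/-- Polynomials of degree less than `n` in `z̄` with entire coefficients. -/
def IsPolyanalytic (n : ℕ) (F : ℂ → ℂ) : Prop :=
  ∃ f : ℕ → ℂ → ℂ, (∀ k, Differentiable ℂ (f k)) ∧
    ∀ z, F z = ∑ k ∈ Finset.range n, (starRingEnd ℂ) z ^ k * f k z

theorem contDiff_conj_pow_mul {f : ℂ → ℂ} (hf : Differentiable ℂ f) (k : ℕ) :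
    ContDiff ℝ ∞ (fun z => (starRingEnd ℂ) z ^ k * f z) := by
  have h1 : ContDiff ℝ ∞ f := (hf.contDiff (n := ∞)).restrict_scalars ℝ
  have h2 : ContDiff ℝ ∞ (fun z : ℂ => (starRingEnd ℂ) z) := Complex.conjCLE.contDiff
  exact (h2.pow k).mul h1

theorem IsPolyanalytic.contDiff {n : ℕ} {F : ℂ → ℂ} (h : IsPolyanalytic n F) :
    ContDiff ℝ ∞ F := by
  obtain ⟨f, hf, hF⟩ := h
  rw [funext hF]
  exact ContDiff.sum fun k _ => contDiff_conj_pow_mul (hf k) k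

theorem dbar_conj_pow_mul {f : ℂ → ℂ} (hf : Differentiable ℂ f) (k : ℕ) (z : ℂ) :
    dbar (fun z => (starRingEnd ℂ) z ^ k * f z) z = k * ((starRingEnd ℂ) z ^ (k - 1) * f z) := by
  have h1 : HasFDerivAt f ((deriv f z) • (1 : ℂ →L[ℝ] ℂ)) z :=
    (hf z).hasDerivAt.complexToReal_fderiv
  have h2 : HasFDerivAt (fun z : ℂ => (starRingEnd ℂ) z) (Complex.conjCLE : ℂ →L[ℝ] ℂ) z :=
    Complex.conjCLE.hasFDerivAt
  have h3 : HasFDerivAt (fun z => (starRingEnd ℂ) z ^ k * f z) _ z := (h2.pow k).mul h1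
  rw [dbar, h3.fderiv]
  simp
  linear_combination (-(1 / 2) * k * (starRingEnd ℂ) z ^ (k - 1) * f z +
    (1 / 2) * (starRingEnd ℂ) z ^ k * deriv f z) * Complex.I_sq

theorem dbar_sum {ι : Type*} (s : Finset ι) {F : ι → ℂ → ℂ}
    (h : ∀ i ∈ s, Differentiable ℝ (F i)) (z : ℂ) :
    dbar (fun z => ∑ i ∈ s, F i z) z = ∑ i ∈ s, dbar (F i) z := by
  simp only [dbar]
  rw [fderiv_fun_sum fun i hi => h i hi z, ← Finset.mul_sum, Finset.sum_add_distrib,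
    ← Finset.mul_sum]
  simp

theorem IsPolyanalytic.dbar {n : ℕ} {F : ℂ → ℂ} (h : IsPolyanalytic (n + 1) F) :
    IsPolyanalytic n (dbar F) := by
  obtain ⟨f, hf, hF⟩ := h
  refine ⟨fun k z => (k + 1 : ℕ) * f (k + 1) z, fun k => (hf _).const_mul _, fun z => ?_⟩
  rw [funext hF, dbar_sum _ fun k _ => (contDiff_conj_pow_mul (hf k) k).differentiable (by simp)]
  simp_rw [dbar_conj_pow_mul (hf _)]
  rw [Finset.sum_range_succ']
  simp only [Nat.add_sub_cancel, Nat.cast_zero, zero_mul, add_zero]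
  exact Finset.sum_congr rfl fun k _ => by ring

theorem IsPolyanalytic.iterate_dbar {n : ℕ} {F : ℂ → ℂ} (h : IsPolyanalytic n F) (z : ℂ) :
    (Bicomplex.dbar^[n] F) z = 0 := by
  induction n generalizing F with
  | zero => obtain ⟨f, hf, hF⟩ := h; simp [hF]
  | succ n ih => exact ih h.dbar

theorem contDiff_dbar {F : ℂ → ℂ} (h : ContDiff ℝ ∞ F) : ContDiff ℝ ∞ (dbar F) := by
  have h1 : ContDiff ℝ ∞ (fderiv ℝ F) := h.fderiv_right (by simp)
  unfold dbar
  exact contDiff_const.mul ((h1.clm_apply contDiff_const).add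
    (contDiff_const.mul (h1.clm_apply contDiff_const)))

theorem differentiable_of_dbar_eq_zero {F : ℂ → ℂ} (h : Differentiable ℝ F)
    (h0 : ∀ z, dbar F z = 0) : Differentiable ℂ F := by
  intro z
  rw [differentiableAt_complex_iff_differentiableAt_real]
  refine ⟨h z, ?_⟩
  have := h0 z
  rw [dbar] at this
  rw [smul_eq_mul]
  linear_combination (-2 * Complex.I) * this + fderiv ℝ F z Complex.I * Complex.I_sq

/-- Induction by integrating in `z̄`: if `dbar F` is a polynomial in `z̄`, its termwise primitive
`S` has the same `dbar`, and `F - S` is entire by the Cauchy–Riemann equation. It becomes the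
coefficient of `z̄^0`. -/
theorem isPolyanalytic_of_iterate_dbar {n : ℕ} {F : ℂ → ℂ} (h : ContDiff ℝ ∞ F)
    (h0 : ∀ z, (dbar^[n] F) z = 0) : IsPolyanalytic n F := by
  induction n generalizing F with
  | zero => exact ⟨fun _ _ => 0, fun _ => differentiable_const _, fun z => by simpa using h0 z⟩
  | succ n ih =>
    obtain ⟨f, hf, hF⟩ := ih (contDiff_dbar h) h0
    have hd : ∀ k, Differentiable ℝ
        (fun z => (starRingEnd ℂ) z ^ (k + 1) * ((1 / (k + 1 : ℕ) : ℂ) * f k z)) := fun k =>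
      (contDiff_conj_pow_mul ((hf k).const_mul _) (k + 1)).differentiable (by simp)
    set S : ℂ → ℂ := fun z => ∑ k ∈ Finset.range n,
      (starRingEnd ℂ) z ^ (k + 1) * ((1 / (k + 1 : ℕ) : ℂ) * f k z) with hS
    have hSd : Differentiable ℝ S := Differentiable.fun_sum fun k _ => hd k
    have hFd : Differentiable ℝ F := h.differentiable (by simp)
    have hg : Differentiable ℂ (fun z => F z - S z) := by
      refine differentiable_of_dbar_eq_zero (hFd.sub hSd) fun z => ?_
      have e : dbar (fun z => F z - S z) z = dbar F z - dbar S z := by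
        simp only [dbar]
        rw [fderiv_fun_sub (hFd z) (hSd z)]
        simp
        ring
      rw [e, hF, hS, dbar_sum _ fun k _ => hd k, ← Finset.sum_sub_distrib]
      refine Finset.sum_eq_zero fun k _ => ?_
      rw [dbar_conj_pow_mul ((hf k).const_mul _)]
      have : ((k + 1 : ℕ) : ℂ) ≠ 0 := Nat.cast_ne_zero.2 (Nat.succ_ne_zero k)
      rw [Nat.add_sub_cancel]
      field_simp
      ring
    refine ⟨fun k => match k with
      | 0 => fun z => F z - S z
      | k + 1 => fun z => (1 / (k + 1 : ℕ) : ℂ) * f k z, fun k => ?_, fun z => ?_⟩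
    · rcases k with _ | k
      · exact hg
      · exact (hf k).const_mul _
    · rw [Finset.sum_range_succ']
      simp [hS]

theorem IsPolyanalytic.add {n : ℕ} {F G : ℂ → ℂ} (hF : IsPolyanalytic n F)
    (hG : IsPolyanalytic n G) : IsPolyanalytic n (fun z => F z + G z) := by
  obtain ⟨f, hf, hF⟩ := hF
  obtain ⟨g, hg, hG⟩ := hG
  refine ⟨fun k z => f k z + g k z, fun k => (hf k).add (hg k), fun z => ?_⟩
  simp only [hF, hG, mul_add, Finset.sum_add_distrib]

theorem IsPolyanalytic.mono {m n : ℕ} (hmn : m ≤ n) {F : ℂ → ℂ} (hF : IsPolyanalytic m F) :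
    IsPolyanalytic n F := by
  obtain ⟨f, hf, hF⟩ := hF
  refine ⟨fun k z => if k < m then f k z else 0, fun k => ?_, fun z => ?_⟩
  · by_cases h : k < m
    · simpa [h] using hf k
    · simp [h]
  · rw [hF, ← Finset.sum_subset (Finset.range_mono hmn)]
    · exact Finset.sum_congr rfl fun k hk => by simp [Finset.mem_range.1 hk]
    · intro k _ hk
      simp [Finset.mem_range.not.1 hk]

theorem IsPolyanalytic.sum {ι : Type*} (s : Finset ι) {n : ℕ} {F : ι → ℂ → ℂ}
    (h : ∀ i ∈ s, IsPolyanalytic n (F i)) : IsPolyanalytic n (fun z => ∑ i ∈ s, F i z) := by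
  classical
  induction s using Finset.induction_on with
  | empty => exact ⟨fun _ _ => 0, fun _ => differentiable_const _, fun z => by simp⟩
  | insert a s ha ih =>
    simp_rw [Finset.sum_insert ha]
    exact (h a (Finset.mem_insert_self a s)).add
      (ih fun i hi => h i (Finset.mem_insert_of_mem hi))

theorem isPolyanalytic_bargmann (σ : ℝ) (hσ : 0 < σ) (n : ℕ) {φ : ℝ → ℂ} (hφ : MemLp φ 2) :
    IsPolyanalytic (n + 1) (bargmann σ n φ) :=
  ⟨_, fun _ => (differentiable_bargmannHolo σ hσ _ hφ).const_mul _,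
    fun z => bargmann_eq_sum σ hσ n hφ z⟩

theorem continuous_bargmann (σ : ℝ) (hσ : 0 < σ) (n : ℕ) {φ : ℝ → ℂ} (hφ : MemLp φ 2) :
    Continuous (bargmann σ n φ) :=
  (isPolyanalytic_bargmann σ hσ n hφ).contDiff.continuous

/-! ### Plancherel and Moyal's identity -/

section

open scoped FourierTransform SchwartzMap

/-- On `L¹ ∩ L²` the `L²` Fourier transform is the Fourier integral. -/
theorem coeFn_fourier_toLp {u : ℝ → ℂ} (h1 : Integrable u) (h2 : MemLp u 2) :
    (𝓕 (h2.toLp u) : Lp ℂ 2 (volume : Measure ℝ)) =ᵐ[volume] 𝓕 u := by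
  have hc : Continuous (𝓕 u) :=
    VectorFourier.fourierIntegral_continuous Real.continuous_fourierChar (by fun_prop) h1
  refine ae_eq_of_integral_contDiff_smul_eq
    ((Lp.memLp _).locallyIntegrable one_le_two) hc.locallyIntegrable ?_
  -- Tested against `g`, the left side is a tempered distribution whose Fourier transform moves onto
  -- `g`; the right side obeys the multiplication formula for integrable functions. The two pairings
  -- agree.
  intro g g_smooth g_cpt
  have hg₁ : HasCompactSupport (Complex.ofRealCLM ∘ g) := g_cpt.comp_left rfl
  have hg₂ : ContDiff ℝ ∞ (Complex.ofRealCLM ∘ g) := by fun_prop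
  set s : 𝓢(ℝ, ℂ) := hg₁.toSchwartzMap hg₂ with hs
  have e1 : ∫ x, g x • (𝓕 (h2.toLp u) : Lp ℂ 2 (volume : Measure ℝ)) x =
      Lp.toTemperedDistribution (𝓕 (h2.toLp u) : Lp ℂ 2 (volume : Measure ℝ)) s := by
    rw [Lp.toTemperedDistribution_apply]
    rfl
  have e2 : Lp.toTemperedDistribution (𝓕 (h2.toLp u) : Lp ℂ 2 (volume : Measure ℝ)) s =
      ∫ x, (𝓕 s : 𝓢(ℝ, ℂ)) x • u x := by
    rw [← Lp.fourier_toTemperedDistribution_eq, TemperedDistribution.fourier_apply,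
      Lp.toTemperedDistribution_apply]
    refine integral_congr_ae ?_
    filter_upwards [h2.coeFn_toLp] with x hx
    rw [hx]
  have e3 := VectorFourier.integral_fourierIntegral_smul_eq_flip (μ := (volume : Measure ℝ))
    (ν := (volume : Measure ℝ)) (L := (innerₗ ℝ : ℝ →ₗ[ℝ] ℝ →ₗ[ℝ] ℝ)) (f := s) (g := u)
    Real.continuous_fourierChar (by fun_prop) s.integrable h1
  rw [e1, e2]
  have hflip : (innerₗ ℝ : ℝ →ₗ[ℝ] ℝ →ₗ[ℝ] ℝ).flip = innerₗ ℝ := flip_innerₗ ℝ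
  rw [hflip] at e3
  have e4 : ∀ x, (𝓕 s : 𝓢(ℝ, ℂ)) x = 𝓕 (s : ℝ → ℂ) x := fun x => by
    rw [SchwartzMap.fourier_coe]
  simp_rw [e4]
  exact e3

theorem memLp_fourier {u : ℝ → ℂ} (h1 : Integrable u) (h2 : MemLp u 2) : MemLp (𝓕 u) 2 :=
  (memLp_congr_ae (coeFn_fourier_toLp h1 h2)).1 (Lp.memLp _)

theorem integral_fourier_mul_conj_fourier {u v : ℝ → ℂ} (hu : Integrable u) (hu2 : MemLp u 2)
    (hv : Integrable v) (hv2 : MemLp v 2) :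
    ∫ w, 𝓕 u w * (starRingEnd ℂ) (𝓕 v w) = ∫ t, u t * (starRingEnd ℂ) (v t) := by
  -- The inner product is conjugate linear in its first argument, so `v` comes first.
  have h := Lp.inner_fourier_eq (hv2.toLp v) (hu2.toLp u)
  rw [L2.inner_def, L2.inner_def] at h
  calc _ = ∫ w, inner ℂ ((𝓕 (hv2.toLp v) : Lp ℂ 2 (volume : Measure ℝ)) w)
        ((𝓕 (hu2.toLp u) : Lp ℂ 2 (volume : Measure ℝ)) w) := by
        refine integral_congr_ae ?_
        filter_upwards [coeFn_fourier_toLp hu hu2, coeFn_fourier_toLp hv hv2] with w h1 h2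
        rw [h1, h2, RCLike.inner_apply]
    _ = _ := by
        rw [h]
        refine integral_congr_ae ?_
        filter_upwards [hu2.coeFn_toLp, hv2.coeFn_toLp] with w h1 h2
        rw [h1, h2, RCLike.inner_apply]

/-- The weighted Bargmann transform `e^{-σ|z|²/4} F_nφ(z)`. -/
def waveTransform (σ : ℝ) (n : ℕ) (φ : ℝ → ℂ) (z : ℂ) : ℂ :=
  Real.exp (-(σ / 4) * ‖z‖ ^ 2) * bargmann σ n φ z

theorem continuous_waveTransform (σ : ℝ) (hσ : 0 < σ) (n : ℕ) {φ : ℝ → ℂ} (hφ : MemLp φ 2) :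
    Continuous (waveTransform σ n φ) := by
  have := continuous_bargmann σ hσ n hφ
  unfold waveTransform
  fun_prop

/-- The weight cancels the growth of the kernel, leaving the short-time Fourier transform with
window `h_n^σ`, up to a phase and a scaling of frequency. -/
theorem waveTransform_eq_integral (σ : ℝ) (n : ℕ) (φ : ℝ → ℂ) (z : ℂ) :
    waveTransform σ n φ z = ∫ t : ℝ, φ t * (Complex.exp (Complex.I * σ * (t - z.re / 2) * z.im) *
        hermiteFunction σ n (t - z.re)) := by
  unfold waveTransform bargmann
  rw [← integral_const_mul]
  refine integral_congr_ae (Filter.Eventually.of_forall fun t => ?_)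
  have : (Real.exp (-(σ / 4) * ‖z‖ ^ 2) : ℂ) * Real.exp (σ / 4 * ‖z‖ ^ 2) = 1 := by
    rw [← Complex.ofReal_mul, ← Real.exp_add]
    simp
  simp only [kernel_mul_eval_eq]
  linear_combination (φ t * (Complex.exp (Complex.I * σ * (t - z.re / 2) * z.im) *
        hermiteFunction σ n (t - z.re))) * this

theorem waveTransform_eq_fourier (σ : ℝ) (n : ℕ) (φ : ℝ → ℂ) (z : ℂ) :
    waveTransform σ n φ z = Complex.exp (-(Complex.I * σ * z.re * z.im / 2)) *
      𝓕 (fun t : ℝ => φ t * (hermiteFunction σ n (t - z.re) : ℂ))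
        (-(σ / (2 * Real.pi)) * z.im) := by
  rw [waveTransform_eq_integral, Real.fourier_real_eq_integral_exp_smul, ← integral_const_mul]
  refine integral_congr_ae (Filter.Eventually.of_forall fun t => ?_)
  have : Complex.exp (Complex.I * σ * (t - z.re / 2) * z.im) =
      Complex.exp (-(Complex.I * σ * z.re * z.im / 2)) *
        Complex.exp (((-2 * Real.pi * t * (-(σ / (2 * Real.pi)) * z.im) : ℝ) : ℂ) * Complex.I) := by
    rw [← Complex.exp_add]
    congr 1
    have hpi : (Real.pi : ℂ) ≠ 0 := by exact_mod_cast Real.pi_ne_zero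
    push_cast
    field_simp
    ring
  simp only [this, smul_eq_mul]
  ring

/-- The phase in front of the Fourier transform depends on `z` only and has modulus one, so it drops
out of the product. -/
theorem waveTransform_mul_conj (σ : ℝ) (j k : ℕ) (φ ψ : ℝ → ℂ) (z : ℂ) :
    waveTransform σ j φ z * (starRingEnd ℂ) (waveTransform σ k ψ z) =
      𝓕 (fun t : ℝ => φ t * (hermiteFunction σ j (t - z.re) : ℂ))
        (-(σ / (2 * Real.pi)) * z.im) *
      (starRingEnd ℂ) (𝓕 (fun t : ℝ => ψ t * (hermiteFunction σ k (t - z.re) : ℂ))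
        (-(σ / (2 * Real.pi)) * z.im)) := by
  rw [waveTransform_eq_fourier, waveTransform_eq_fourier, map_mul, ← Complex.exp_conj]
  have : Complex.exp (-(Complex.I * σ * z.re * z.im / 2)) *
      Complex.exp ((starRingEnd ℂ) (-(Complex.I * σ * z.re * z.im / 2))) = 1 := by
    rw [← Complex.exp_add, ← Complex.exp_zero]
    congr 1
    simp [Complex.conj_ofNat]
    ring
  linear_combination (𝓕 (fun t : ℝ => φ t * (hermiteFunction σ j (t - z.re) : ℂ))
        (-(σ / (2 * Real.pi)) * z.im) *
      (starRingEnd ℂ) (𝓕 (fun t : ℝ => ψ t * (hermiteFunction σ k (t - z.re) : ℂ))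
        (-(σ / (2 * Real.pi)) * z.im))) * this

theorem memLp_hermiteFunction_sub (σ : ℝ) (hσ : 0 < σ) (n : ℕ) (x : ℝ) :
    MemLp (fun t => (hermiteFunction σ n (t - x) : ℂ)) 2 :=
  (memLp_hermiteFunction σ hσ n).comp_measurePreserving
    (measurePreserving_sub_right (volume : Measure ℝ) x)

theorem integrable_mul_hermiteFunction_sub (σ : ℝ) (hσ : 0 < σ) (n : ℕ) {φ : ℝ → ℂ}
    (hφ : MemLp φ 2) (x : ℝ) :
    Integrable (fun t : ℝ => φ t * (hermiteFunction σ n (t - x) : ℂ)) :=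
  hφ.integrable_mul (memLp_hermiteFunction_sub σ hσ n x)

theorem memLp_mul_hermiteFunction_sub (σ : ℝ) (hσ : 0 < σ) (n : ℕ) {φ : ℝ → ℂ}
    (hφ : MemLp φ 2) (x : ℝ) :
    MemLp (fun t : ℝ => φ t * (hermiteFunction σ n (t - x) : ℂ)) 2 := by
  obtain ⟨C, hC, h⟩ := exists_abs_hermiteFunction_le σ hσ n
  have hc : Continuous fun t : ℝ => (hermiteFunction σ n (t - x) : ℂ) :=
    Complex.continuous_ofReal.comp ((continuous_hermiteFunction σ n).comp (by fun_prop))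
  have hb : MemLp (fun t : ℝ => (hermiteFunction σ n (t - x) : ℂ)) ∞ := by
    refine memLp_top_of_bound hc.aestronglyMeasurable C (Filter.Eventually.of_forall fun t => ?_)
    rw [Complex.norm_real]
    refine (h _).trans (mul_le_of_le_one_right hC ?_)
    rw [Real.exp_le_one_iff]
    have := sq_nonneg (t - x)
    nlinarith
  exact hb.mul hφ

theorem abs_inv_fourier_scale (σ : ℝ) (hσ : 0 < σ) :
    |(-(σ / (2 * Real.pi)))⁻¹| = 2 * Real.pi / σ := by
  have := Real.pi_pos
  rw [abs_inv, abs_neg, abs_of_pos (by positivity), inv_div]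

/-- Parseval on the line `Re z = x`; the factor `2π/σ` is the Jacobian of the frequency scaling. -/
theorem integral_slice (σ : ℝ) (hσ : 0 < σ) (j k : ℕ) {φ ψ : ℝ → ℂ} (hφ : MemLp φ 2)
    (hψ : MemLp ψ 2) (x : ℝ) :
    ∫ y : ℝ, waveTransform σ j φ ⟨x, y⟩ * (starRingEnd ℂ) (waveTransform σ k ψ ⟨x, y⟩) =
      (2 * Real.pi / σ) * ∫ t : ℝ, φ t * (starRingEnd ℂ) (ψ t) *
        (hermiteFunction σ j (t - x) * hermiteFunction σ k (t - x) : ℝ) := by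
  simp_rw [waveTransform_mul_conj]
  rw [Measure.integral_comp_mul_left (fun w : ℝ =>
    𝓕 (fun t : ℝ => φ t * (hermiteFunction σ j (t - x) : ℂ)) w *
      (starRingEnd ℂ) (𝓕 (fun t : ℝ => ψ t * (hermiteFunction σ k (t - x) : ℂ)) w)),
    abs_inv_fourier_scale σ hσ, integral_fourier_mul_conj_fourier
      (integrable_mul_hermiteFunction_sub σ hσ j hφ x) (memLp_mul_hermiteFunction_sub σ hσ j hφ x)
      (integrable_mul_hermiteFunction_sub σ hσ k hψ x) (memLp_mul_hermiteFunction_sub σ hσ k hψ x),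
    Complex.real_smul]
  push_cast
  congr 1
  refine integral_congr_ae (Filter.Eventually.of_forall fun t => ?_)
  simp only [map_mul, Complex.conj_ofReal]
  ring

theorem integrable_slice (σ : ℝ) (hσ : 0 < σ) (n : ℕ) {φ : ℝ → ℂ} (hφ : MemLp φ 2) (x : ℝ) :
    Integrable (fun y : ℝ => ‖waveTransform σ n φ ⟨x, y⟩‖ ^ 2) := by
  have h := memLp_fourier (integrable_mul_hermiteFunction_sub σ hσ n hφ x)
    (memLp_mul_hermiteFunction_sub σ hσ n hφ x)
  have h2 := (memLp_two_iff_integrable_sq_norm h.aestronglyMeasurable).1 h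
  have hne : -(σ / (2 * Real.pi)) ≠ 0 := by
    have := Real.pi_pos
    exact neg_ne_zero.2 (by positivity)
  refine (h2.comp_mul_left' hne).congr (Filter.Eventually.of_forall fun y => ?_)
  have : ∀ w : ℂ, ((‖w‖ ^ 2 : ℝ) : ℂ) = w * (starRingEnd ℂ) w := fun w => by
    rw [Complex.mul_conj, Complex.normSq_eq_norm_sq]
  have h3 := waveTransform_mul_conj σ n n φ φ ⟨x, y⟩
  rw [← this, ← this] at h3
  exact_mod_cast h3.symm

theorem integrable_convolution_integrand (σ : ℝ) (hσ : 0 < σ) (j k : ℕ) {φ ψ : ℝ → ℂ}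
    (hφ : MemLp φ 2) (hψ : MemLp ψ 2) :
    Integrable (fun p : ℝ × ℝ => φ p.2 * (starRingEnd ℂ) (ψ p.2) *
        ((hermiteFunction σ j (p.2 - p.1) * hermiteFunction σ k (p.2 - p.1) : ℝ) : ℂ))
      (volume.prod volume) := by
  have h1 : Integrable (fun t => φ t * (starRingEnd ℂ) (ψ t)) := hφ.integrable_mul hψ.star
  -- The window product is reflected because the convolution integrand evaluates its second function
  -- at `x - t`.
  have h2 : Integrable (fun t : ℝ =>
      ((hermiteFunction σ j (-t) * hermiteFunction σ k (-t) : ℝ) : ℂ)) :=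
    (integrable_hermiteFunction_mul σ hσ j k).comp_neg.ofReal
  have := h1.convolution_integrand (ContinuousLinearMap.mul ℂ ℂ) h2
  simpa using this

theorem memLp_waveTransform (σ : ℝ) (hσ : 0 < σ) (n : ℕ) {φ : ℝ → ℂ} (hφ : MemLp φ 2) :
    MemLp (waveTransform σ n φ) 2 := by
  have hc := continuous_waveTransform σ hσ n hφ
  rw [memLp_two_iff_integrable_sq_norm hc.aestronglyMeasurable]
  rw [← (Complex.volume_preserving_equiv_real_prod.symm _).integrable_comp_emb
    (MeasurableEquiv.measurableEmbedding _)]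
  have hm : AEStronglyMeasurable ((fun z : ℂ => ‖waveTransform σ n φ z‖ ^ 2) ∘
      Complex.measurableEquivRealProd.symm) (volume.prod volume) := by
    have : Measurable (fun z : ℂ => ‖waveTransform σ n φ z‖ ^ 2) := (hc.norm.pow 2).measurable
    exact (this.comp (MeasurableEquiv.measurable _)).aestronglyMeasurable
  refine (integrable_prod_iff hm).2
    ⟨Filter.Eventually.of_forall fun x => integrable_slice σ hσ n hφ x, ?_⟩
  -- The slice integrals of `|W|²` are nonnegative, so they equal the norms of the integrals in
  -- `integral_slice`, which are integrable in `x`.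
  have h3 := ((integrable_convolution_integrand σ hσ n n hφ hφ).integral_prod_left.const_mul
    (2 * Real.pi / σ : ℂ)).norm
  refine h3.congr (Filter.Eventually.of_forall fun x => ?_)
  have h4 := integral_slice σ hσ n n hφ hφ x
  simp only [Function.comp_def, Complex.measurableEquivRealProd_symm_apply]
  rw [← h4]
  have : ∀ w : ℂ, w * (starRingEnd ℂ) w = ((‖w‖ ^ 2 : ℝ) : ℂ) := fun w => by
    rw [Complex.mul_conj, Complex.normSq_eq_norm_sq]
  simp_rw [this]
  rw [integral_complex_ofReal, Complex.norm_real,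
    Real.norm_of_nonneg (integral_nonneg fun y => by positivity)]
  simp

/-- Moyal's identity. -/
theorem integral_waveTransform_mul_conj (σ : ℝ) (hσ : 0 < σ) (j k : ℕ) {φ ψ : ℝ → ℂ}
    (hφ : MemLp φ 2) (hψ : MemLp ψ 2) :
    ∫ z : ℂ, waveTransform σ j φ z * (starRingEnd ℂ) (waveTransform σ k ψ z) =
      (2 * Real.pi / σ * ∫ t, hermiteFunction σ j t * hermiteFunction σ k t : ℝ) *
        ∫ t : ℝ, φ t * (starRingEnd ℂ) (ψ t) := by
  have hint : Integrable fun z : ℂ =>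
      waveTransform σ j φ z * (starRingEnd ℂ) (waveTransform σ k ψ z) :=
    (memLp_waveTransform σ hσ j hφ).integrable_mul (memLp_waveTransform σ hσ k hψ).star
  have hmp := Complex.volume_preserving_equiv_real_prod.symm Complex.measurableEquivRealProd
  rw [← hmp.integral_comp (MeasurableEquiv.measurableEmbedding _)]
  rw [← hmp.integrable_comp_emb (MeasurableEquiv.measurableEmbedding _)] at hint
  rw [Measure.volume_eq_prod] at hint ⊢
  simp only [Function.comp_def] at hint
  rw [integral_prod _ hint]
  simp only [Complex.measurableEquivRealProd_symm_apply]
  simp_rw [integral_slice σ hσ j k hφ hψ]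
  -- After the swap, the inner integral over `x` is independent of `t` by translation and reflection
  -- invariance, and the double integral factors.
  rw [integral_const_mul, integral_integral_swap
    (integrable_convolution_integrand σ hσ j k hφ hψ)]
  simp_rw [integral_const_mul]
  have : ∀ t : ℝ, ∫ x : ℝ, ((hermiteFunction σ j (t - x) * hermiteFunction σ k (t - x) : ℝ) : ℂ) =
      (∫ s, hermiteFunction σ j s * hermiteFunction σ k s : ℝ) := fun t => by
    rw [integral_complex_ofReal,
      integral_sub_left_eq_self (fun s => hermiteFunction σ j s * hermiteFunction σ k s)]
  simp_rw [this]
  rw [integral_mul_const]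
  push_cast
  ring

end

/-! ### Angular Fourier modes and uniqueness -/

theorem fourier_natCast (n : ℕ) (x : UnitAddCircle) :
    fourier (n : ℤ) x = (fourier 1 x : ℂ) ^ n := by
  induction n with
  | zero => simp
  | succ n ih => rw [pow_succ, ← ih, Nat.cast_succ, fourier_add]

theorem fourier_mul_conj (d : ℤ) (x : UnitAddCircle) :
    fourier d x * (starRingEnd ℂ) (fourier d x) = 1 := by
  rw [← fourier_neg, ← fourier_add, add_neg_cancel, fourier_zero]

theorem norm_fourier_apply (d : ℤ) (x : UnitAddCircle) : ‖(fourier d x : ℂ)‖ = 1 :=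
  Circle.norm_coe _

/-- The angular Fourier coefficients of a function on the plane. -/
def angularMode (d : ℤ) (G : ℂ → ℂ) (z : ℂ) : ℂ :=
  fourierCoeff (fun x : UnitAddCircle => G (fourier 1 x * z)) d

/-- Integrating the Taylor series term by term over the circle leaves only the monomial of degree
`d`, and nothing when `d` is negative; the alternative `c = 0` covers that case. -/
theorem angularMode_entire {f : ℂ → ℂ} (hf : Differentiable ℂ f) (d : ℤ) :
    ∃ (c : ℂ) (a : ℕ), (c = 0 ∨ (a : ℤ) = d) ∧ ∀ z, angularMode d f z = c * z ^ a := by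
  set c : ℕ → ℂ := fun n => (n.factorial : ℂ)⁻¹ * iteratedDeriv n f 0 with hc
  have hs : ∀ w, HasSum (fun n => c n * w ^ n) (f w) := fun w => by
    have := Complex.hasSum_taylorSeries_of_entire hf 0 w
    simp only [sub_zero, smul_eq_mul] at this
    refine this.congr_fun fun n => ?_
    simp only [hc]
    ring
  have key : ∀ z, HasSum (fun n : ℕ => c n * z ^ n * (if (n : ℤ) = d then 1 else 0))
      (angularMode d f z) := by
    intro z
    have e : ∀ (n : ℕ) (x : UnitAddCircle), fourier (-d) x • (c n * (fourier 1 x * z) ^ n) =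
        c n * z ^ n * (fourier (-d) x • fourier (n : ℤ) x) := fun n x => by
      rw [fourier_natCast, smul_eq_mul, smul_eq_mul]; ring
    have h := hasSum_integral_of_summable_integral_norm (μ := AddCircle.haarAddCircle (T := (1 : ℝ)))
      (F := fun (n : ℕ) (x : UnitAddCircle) => fourier (-d) x • (c n * (fourier 1 x * z) ^ n))
      (fun n => ?_) ?_
    · have h1 : ∀ x : UnitAddCircle, ∑' n : ℕ, fourier (-d) x • (c n * (fourier 1 x * z) ^ n) =
          fourier (-d) x • f (fourier 1 x * z) := fun x => ((hs _).const_smul _).tsum_eq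
      simp_rw [h1, e, integral_const_mul] at h
      have h2 : ∀ n : ℕ, ∫ x : UnitAddCircle, (fourier (-d) x • fourier (n : ℤ) x : ℂ)
          ∂AddCircle.haarAddCircle = if (n : ℤ) = d then 1 else 0 := fun n => by
        have := congrFun (fourierCoeff_fourier (T := (1 : ℝ)) (n : ℤ)) d
        rw [fourierCoeff] at this
        rw [this, Pi.single_apply]
        simp [eq_comm]
      simp_rw [h2] at h
      exact h
    · have hcont : Continuous fun x : UnitAddCircle =>
          fourier (-d) x • (c n * (fourier 1 x * z) ^ n) := by fun_prop
      exact hcont.integrable_of_hasCompactSupport (HasCompactSupport.of_compactSpace _)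
    · simp only [norm_smul, norm_mul, norm_pow, norm_fourier_apply, one_mul, integral_const]
      simpa using (hs z).summable.norm
  by_cases hd : ∃ a : ℕ, (a : ℤ) = d
  · obtain ⟨a, ha⟩ := hd
    refine ⟨c a, a, Or.inr ha, fun z => ?_⟩
    have h2 := hasSum_single (f := fun n : ℕ => c n * z ^ n * (if (n : ℤ) = d then 1 else 0)) a
      fun n hn => by
        have : (n : ℤ) ≠ d := fun h => hn (by omega)
        simp [this]
    rw [(key z).unique h2]
    simp [ha]
  · refine ⟨0, 0, Or.inl rfl, fun z => ?_⟩
    have h0 : ∀ n : ℕ, (n : ℤ) ≠ d := fun n hn => hd ⟨n, hn⟩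
    have := key z
    simp only [h0, if_false, mul_zero] at this
    rw [this.unique hasSum_zero]; simp

theorem continuous_comp_rotate {G : ℂ → ℂ} (hG : Continuous G) (z : ℂ) :
    Continuous fun x : UnitAddCircle => G (fourier 1 x * z) := by fun_prop

theorem integrable_fourier_smul {g : UnitAddCircle → ℂ} (hg : Continuous g) (d : ℤ) :
    Integrable (fun x => fourier d x • g x) AddCircle.haarAddCircle := by
  have : Continuous fun x => fourier d x • g x := by fun_prop
  exact this.integrable_of_hasCompactSupport (HasCompactSupport.of_compactSpace _)

/-- A rotation multiplies `z̄^k` by the character of index `-k`, so the mode `d` of `z̄^k f_k` is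
`z̄^k` times the mode `d + k` of `f_k`, a monomial. -/
theorem angularMode_polyanalytic {n : ℕ} {G : ℂ → ℂ} (hG : IsPolyanalytic n G) (d : ℤ) :
    ∃ (c : ℕ → ℂ) (a : ℕ → ℕ), (∀ k, c k = 0 ∨ (a k : ℤ) = d + k) ∧
      ∀ z, angularMode d G z = ∑ k ∈ Finset.range n, c k * (z ^ a k * (starRingEnd ℂ) z ^ k) := by
  obtain ⟨f, hf, hF⟩ := hG
  choose c a hca h using fun k : ℕ => angularMode_entire (hf k) (d + k)
  refine ⟨c, a, hca, fun z => ?_⟩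
  have e : ∀ x : UnitAddCircle, fourier (-d) x • G (fourier 1 x * z) =
      ∑ k ∈ Finset.range n, (starRingEnd ℂ) z ^ k *
        (fourier (-(d + k)) x • f k (fourier 1 x * z)) := fun x => by
    rw [hF, Finset.smul_sum]
    refine Finset.sum_congr rfl fun k _ => ?_
    rw [map_mul, mul_pow, neg_add, fourier_add, ← map_pow, ← fourier_natCast, ← fourier_neg]
    simp only [smul_eq_mul]
    ring
  rw [angularMode, fourierCoeff]
  simp_rw [e]
  rw [integral_finsetSum]
  · refine Finset.sum_congr rfl fun k _ => ?_
    rw [integral_const_mul]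
    have := h k z
    rw [angularMode, fourierCoeff] at this
    rw [this]
    ring
  · intro k _
    exact (integrable_fourier_smul (continuous_comp_rotate (hf k).continuous z) _).const_mul _

/-- On the circle through `z` all Fourier coefficients vanish, so the Fourier series is summable and
represents the continuous function pointwise; its value at angle 0 is `G z`. -/
theorem eq_zero_of_angularMode_eq_zero {G : ℂ → ℂ} (hG : Continuous G) (z : ℂ)
    (h : ∀ d, angularMode d G z = 0) : G z = 0 := by
  set g : C(UnitAddCircle, ℂ) := ⟨_, continuous_comp_rotate hG z⟩ with hg
  have h0 : fourierCoeff g = 0 := funext h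
  have := has_pointwise_sum_fourier_series_of_summable (f := g) (by rw [h0]; exact summable_zero) 0
  rw [h0] at this
  simp only [Pi.zero_apply, zero_smul] at this
  have h1 := this.unique hasSum_zero
  simpa [hg] using h1

theorem measurePreserving_rotate (x : UnitAddCircle) :
    MeasurePreserving (fun z : ℂ => fourier 1 x * z) := by
  have := (rotation x.toCircle).measurePreserving
  have e : (fun z : ℂ => fourier 1 x * z) = rotation x.toCircle := by
    funext z
    rw [rotation_apply, fourier_one]
  rwa [e]

theorem measurableEmbedding_rotate (x : UnitAddCircle) :
    MeasurableEmbedding (fun z : ℂ => fourier 1 x * z) := by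
  have := (rotation x.toCircle).toHomeomorph.measurableEmbedding
  have e : (fun z : ℂ => fourier 1 x * z) = rotation x.toCircle := by
    funext z
    rw [rotation_apply, fourier_one]
  rwa [e]

/-- A weighted square integrable polyanalytic function orthogonal to all polynomials of the same
order vanishes. -/
theorem eq_zero_of_orthogonal_monomials {n : ℕ} {G : ℂ → ℂ} (hG : IsPolyanalytic n G) {w : ℂ → ℝ}
    (hw : Continuous w) (hpos : ∀ z, 0 < w z) (hrot : ∀ (u z : ℂ), ‖u‖ = 1 → w (u * z) = w z)
    (h2 : MemLp (fun z => (w z : ℂ) * G z) 2)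
    (hmem : ∀ a b : ℕ, MemLp (fun z => (w z : ℂ) * (z ^ a * (starRingEnd ℂ) z ^ b)) 2)
    (horth : ∀ a b : ℕ, b < n → ∫ z : ℂ, ((w z : ℂ) * G z) *
      (starRingEnd ℂ) ((w z : ℂ) * (z ^ a * (starRingEnd ℂ) z ^ b)) = 0) (z : ℂ) : G z = 0 := by
  have hGc : Continuous G := hG.contDiff.continuous
  refine eq_zero_of_angularMode_eq_zero hGc z fun d => ?_
  obtain ⟨c, a, hca, hQ⟩ := angularMode_polyanalytic hG d
  set Q : ℂ → ℂ := angularMode d G with hQdef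
  have hQeq : Q = fun z => ∑ k ∈ Finset.range n, c k * (z ^ a k * (starRingEnd ℂ) z ^ k) :=
    funext hQ
  have hQc : Continuous Q := by rw [hQeq]; fun_prop
  have hwQ : (fun z => (w z : ℂ) * Q z) = fun z => ∑ k ∈ Finset.range n,
      c k * ((w z : ℂ) * (z ^ a k * (starRingEnd ℂ) z ^ k)) := by
    funext z
    rw [hQ, Finset.mul_sum]
    exact Finset.sum_congr rfl fun k _ => by ring
  have hQ2 : MemLp (fun z => (w z : ℂ) * Q z) 2 := by
    rw [hwQ]
    exact memLp_finsetSum _ fun k _ => (hmem (a k) k).const_mul (c k)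
  have hQrot : ∀ (x : UnitAddCircle) (z : ℂ), Q (fourier 1 x * z) = fourier d x * Q z := by
    intro x z
    rw [hQ, hQ, Finset.mul_sum]
    refine Finset.sum_congr rfl fun k _ => ?_
    rcases hca k with h | h
    · simp [h]
    · have : (fourier 1 x : ℂ) ^ a k * (starRingEnd ℂ) (fourier 1 x : ℂ) ^ k = fourier d x := by
        rw [← map_pow (starRingEnd ℂ), ← fourier_natCast, ← fourier_natCast, h, fourier_add, mul_assoc,
          fourier_mul_conj, mul_one]
      rw [map_mul, mul_pow, mul_pow, ← this]
      ring
  -- The integral of `H` is computed twice: it is zero since `Q` is a combination of monomials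
  -- orthogonal to `G`, and averaging over rotations turns it into the squared norm of `wQ`.
  set H : ℂ → ℂ := fun z => ((w z : ℂ) * G z) * (starRingEnd ℂ) ((w z : ℂ) * Q z) with hH
  have hHc : Continuous H := by fun_prop
  have hHi : Integrable H := h2.integrable_mul hQ2.star
  have hH0 : ∫ z, H z = 0 := by
    have e : H = fun z => ∑ k ∈ Finset.range n, (starRingEnd ℂ) (c k) * (((w z : ℂ) * G z) *
        (starRingEnd ℂ) ((w z : ℂ) * (z ^ a k * (starRingEnd ℂ) z ^ k))) := by
      funext z
      have := congrFun hwQ z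
      simp only [hH]
      rw [this, map_sum, Finset.mul_sum]
      refine Finset.sum_congr rfl fun k _ => ?_
      rw [map_mul]
      ring
    rw [e, integral_finsetSum]
    · refine Finset.sum_eq_zero fun k hk => ?_
      rw [integral_const_mul, horth _ _ (Finset.mem_range.1 hk), mul_zero]
    · intro k _
      exact (h2.integrable_mul (hmem (a k) k).star).const_mul _
  have hHrot : ∀ (x : UnitAddCircle) (z : ℂ), H (fourier 1 x * z) =
      (fourier (-d) x • G (fourier 1 x * z)) * ((w z : ℂ) * (starRingEnd ℂ) ((w z : ℂ) * Q z)) := by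
    intro x z
    simp only [hH, hQrot, hrot _ _ (norm_fourier_apply 1 x), map_mul, fourier_neg, smul_eq_mul]
    ring
  have hprod : Integrable (fun p : UnitAddCircle × ℂ => H (fourier 1 p.1 * p.2))
      ((AddCircle.haarAddCircle (T := (1 : ℝ))).prod volume) := by
    have hc : Continuous fun p : UnitAddCircle × ℂ => H (fourier 1 p.1 * p.2) := by fun_prop
    refine (integrable_prod_iff hc.aestronglyMeasurable).2
      ⟨Filter.Eventually.of_forall fun x => ?_, ?_⟩
    · exact ((measurePreserving_rotate x).integrable_comp_emb (measurableEmbedding_rotate x)).2 hHi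
    · have : ∀ x : UnitAddCircle, ∫ z, ‖H (fourier 1 x * z)‖ = ∫ z, ‖H z‖ := fun x =>
        (measurePreserving_rotate x).integral_comp (measurableEmbedding_rotate x) fun z => ‖H z‖
      simp_rw [this]
      exact integrable_const _
  have hswap := integral_integral_swap (f := fun (x : UnitAddCircle) (z : ℂ) =>
    H (fourier 1 x * z)) hprod
  have hl : ∀ x : UnitAddCircle, ∫ z, H (fourier 1 x * z) = 0 := fun x => by
    rw [(measurePreserving_rotate x).integral_comp (measurableEmbedding_rotate x) H, hH0]
  have hr : ∀ z : ℂ, ∫ x : UnitAddCircle, H (fourier 1 x * z) ∂AddCircle.haarAddCircle =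
      ((‖(w z : ℂ) * Q z‖ ^ 2 : ℝ) : ℂ) := fun z => by
    simp_rw [hHrot]
    rw [integral_mul_const, ← Complex.normSq_eq_norm_sq, ← Complex.mul_conj]
    change Q z * _ = _
    ring
  simp_rw [hl, hr] at hswap
  rw [integral_zero, integral_complex_ofReal] at hswap
  have h0 : ∫ z : ℂ, ‖(w z : ℂ) * Q z‖ ^ 2 = 0 := by exact_mod_cast hswap.symm
  rw [integral_eq_zero_iff_of_nonneg (fun z => by positivity)
    ((memLp_two_iff_integrable_sq_norm hQ2.aestronglyMeasurable).1 hQ2)] at h0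
  -- Continuity upgrades vanishing almost everywhere to vanishing at the given `z`.
  have hcn : Continuous fun z : ℂ => ‖(w z : ℂ) * Q z‖ ^ 2 := by fun_prop
  have h1 : ‖(w z : ℂ) * Q z‖ ^ 2 = 0 :=
    congrFun ((hcn.ae_eq_iff_eq volume continuous_const).1 h0) z
  simpa [(hpos z).ne'] using h1

/-! ### Weighted Fock functions and sums of Bargmann transforms -/

/-- The square root `e^{-σ|z|²/4}` of the weight of the Fock spaces. -/
def fockWeight (σ : ℝ) (z : ℂ) : ℝ := Real.exp (-(σ / 4) * ‖z‖ ^ 2)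

theorem continuous_fockWeight (σ : ℝ) : Continuous (fockWeight σ) := by
  unfold fockWeight; fun_prop

theorem fockWeight_pos (σ : ℝ) (z : ℂ) : 0 < fockWeight σ z := Real.exp_pos _

theorem fockWeight_mul_self (σ : ℝ) (z : ℂ) :
    fockWeight σ z * fockWeight σ z = Real.exp (-(σ / 2) * ‖z‖ ^ 2) := by
  rw [fockWeight, ← Real.exp_add]; ring_nf

theorem waveTransform_eq (σ : ℝ) (n : ℕ) (φ : ℝ → ℂ) (z : ℂ) :
    waveTransform σ n φ z = fockWeight σ z * bargmann σ n φ z := rfl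

theorem mem_polyFock_iff (σ : ℝ) (n : ℕ) (F : ℂ → ℂ) :
    F ∈ polyFock (σ / 2) n ↔
      IsPolyanalytic n F ∧ MemLp (fun z => (fockWeight σ z : ℂ) * F z) 2 := by
  have e : ∀ z, ‖F z‖ ^ 2 * Real.exp (-(σ / 2) * ‖z‖ ^ 2) =
      ‖(fockWeight σ z : ℂ) * F z‖ ^ 2 := fun z => by
    rw [norm_mul, Complex.norm_real, Real.norm_of_nonneg (fockWeight_pos σ z).le, mul_pow,
      ← fockWeight_mul_self]
    ring
  have hc : ContDiff ℝ ∞ F → Continuous fun z => (fockWeight σ z : ℂ) * F z := fun h => by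
    have := h.continuous
    have := continuous_fockWeight σ
    fun_prop
  constructor
  · rintro ⟨h1, h2, h3⟩
    refine ⟨isPolyanalytic_of_iterate_dbar h1 h2, ?_⟩
    rw [memLp_two_iff_integrable_sq_norm (hc h1).aestronglyMeasurable]
    simpa only [e] using h3
  · rintro ⟨h1, h2⟩
    refine ⟨h1.contDiff, h1.iterate_dbar, ?_⟩
    rw [memLp_two_iff_integrable_sq_norm (hc h1.contDiff).aestronglyMeasurable] at h2
    simpa only [e] using h2

theorem weighted_integrand_eq (σ : ℝ) (F G : ℂ → ℂ) (z : ℂ) :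
    F z * (starRingEnd ℂ) (G z) * (Real.exp (-(σ / 2) * ‖z‖ ^ 2) : ℂ) =
      ((fockWeight σ z : ℂ) * F z) * (starRingEnd ℂ) ((fockWeight σ z : ℂ) * G z) := by
  rw [← fockWeight_mul_self, map_mul, Complex.conj_ofReal]
  push_cast
  ring

theorem bargmann_congr_ae (σ : ℝ) (n : ℕ) {φ ψ : ℝ → ℂ} (h : φ =ᵐ[volume] ψ) :
    bargmann σ n φ = bargmann σ n ψ := by
  funext z
  refine integral_congr_ae ?_
  filter_upwards [h] with t ht
  rw [ht]

theorem bargmann_add (σ : ℝ) (hσ : 0 < σ) (n : ℕ) {φ ψ : ℝ → ℂ} (hφ : MemLp φ 2)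
    (hψ : MemLp ψ 2) (z : ℂ) :
    bargmann σ n (fun t => φ t + ψ t) z = bargmann σ n φ z + bargmann σ n ψ z := by
  unfold bargmann
  rw [← integral_add (integrable_mul_kernel_mul_eval σ hσ hφ _ z _)
    (integrable_mul_kernel_mul_eval σ hσ hψ _ z _)]
  simp_rw [add_mul]

theorem bargmann_const_mul (σ : ℝ) (n : ℕ) (c : ℂ) (φ : ℝ → ℂ) (z : ℂ) :
    bargmann σ n (fun t => c * φ t) z = c * bargmann σ n φ z := by
  unfold bargmann
  simp_rw [mul_assoc]
  rw [integral_const_mul]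

theorem memLp_fockWeight_mul_bargmann (σ : ℝ) (hσ : 0 < σ) (n : ℕ) {φ : ℝ → ℂ}
    (hφ : MemLp φ 2) : MemLp (fun z => (fockWeight σ z : ℂ) * bargmann σ n φ z) 2 :=
  memLp_waveTransform σ hσ n hφ

/-- Sums of Bargmann transforms of levels below `N`. -/
def IsBargmannSum (σ : ℝ) (N : ℕ) (F : ℂ → ℂ) : Prop :=
  ∃ φ : ℕ → ℝ → ℂ, (∀ k, MemLp (φ k) 2) ∧ ∀ z, F z = ∑ k ∈ Finset.range N, bargmann σ k (φ k) z

theorem IsBargmannSum.add {σ : ℝ} (hσ : 0 < σ) {N : ℕ} {F G : ℂ → ℂ} (hF : IsBargmannSum σ N F)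
    (hG : IsBargmannSum σ N G) : IsBargmannSum σ N (fun z => F z + G z) := by
  obtain ⟨φ, hφ, hF⟩ := hF
  obtain ⟨ψ, hψ, hG⟩ := hG
  refine ⟨fun k t => φ k t + ψ k t, fun k => (hφ k).add (hψ k), fun z => ?_⟩
  simp only [hF, hG, ← Finset.sum_add_distrib]
  exact Finset.sum_congr rfl fun k _ => (bargmann_add σ hσ k (hφ k) (hψ k) z).symm

theorem IsBargmannSum.const_mul {σ : ℝ} {N : ℕ} {F : ℂ → ℂ} (hF : IsBargmannSum σ N F) (c : ℂ) :
    IsBargmannSum σ N (fun z => c * F z) := by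
  obtain ⟨φ, hφ, hF⟩ := hF
  refine ⟨fun k t => c * φ k t, fun k => (hφ k).const_mul c, fun z => ?_⟩
  simp only [hF, Finset.mul_sum]
  exact Finset.sum_congr rfl fun k _ => (bargmann_const_mul σ k c (φ k) z).symm

theorem bargmann_zero_fun (σ : ℝ) (n : ℕ) (z : ℂ) : bargmann σ n (fun _ => 0) z = 0 := by
  simp [bargmann]

theorem isBargmannSum_zero (σ : ℝ) (N : ℕ) : IsBargmannSum σ N (fun _ => 0) :=
  ⟨fun _ _ => 0, fun _ => MemLp.zero', fun z => by simp [bargmann_zero_fun]⟩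

theorem isBargmannSum_bargmann (σ : ℝ) {k N : ℕ} (hk : k < N) {φ : ℝ → ℂ} (hφ : MemLp φ 2) :
    IsBargmannSum σ N (bargmann σ k φ) := by
  refine ⟨fun j => if j = k then φ else fun _ => 0, fun j => ?_, fun z => ?_⟩
  · by_cases h : j = k
    · simpa [h] using hφ
    · simp only [h, if_false]; exact MemLp.zero'
  · rw [Finset.sum_eq_single_of_mem k (Finset.mem_range.2 hk)]
    · simp
    · intro j _ hj
      simp [hj, bargmann_zero_fun]

theorem IsBargmannSum.sum {σ : ℝ} (hσ : 0 < σ) {ι : Type*} (s : Finset ι) {N : ℕ}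
    {F : ι → ℂ → ℂ} (h : ∀ i ∈ s, IsBargmannSum σ N (F i)) :
    IsBargmannSum σ N (fun z => ∑ i ∈ s, F i z) := by
  classical
  induction s using Finset.induction_on with
  | empty => simpa using isBargmannSum_zero σ N
  | insert a s ha ih =>
    simp_rw [Finset.sum_insert ha]
    exact (h a (Finset.mem_insert_self a s)).add hσ
      (ih fun i hi => h i (Finset.mem_insert_of_mem hi))

theorem IsBargmannSum.mono {σ : ℝ} (hσ : 0 < σ) {M N : ℕ} (hMN : M ≤ N) {F : ℂ → ℂ}
    (hF : IsBargmannSum σ M F) : IsBargmannSum σ N F := by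
  obtain ⟨φ, hφ, hF⟩ := hF
  rw [funext hF]
  exact IsBargmannSum.sum hσ _ fun k hk =>
    isBargmannSum_bargmann σ ((Finset.mem_range.1 hk).trans_le hMN) (hφ k)

theorem IsBargmannSum.isPolyanalytic {σ : ℝ} (hσ : 0 < σ) {N : ℕ} {F : ℂ → ℂ}
    (hF : IsBargmannSum σ N F) : IsPolyanalytic N F := by
  obtain ⟨φ, hφ, hF⟩ := hF
  rw [funext hF]
  exact IsPolyanalytic.sum _ fun k hk =>
    -- Level `k` has order `k + 1`, and `k < N` is by definition `k + 1 ≤ N`.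
    (isPolyanalytic_bargmann σ hσ k (hφ k)).mono (Finset.mem_range.1 hk)

theorem IsBargmannSum.memLp {σ : ℝ} (hσ : 0 < σ) {N : ℕ} {F : ℂ → ℂ}
    (hF : IsBargmannSum σ N F) : MemLp (fun z => (fockWeight σ z : ℂ) * F z) 2 := by
  obtain ⟨φ, hφ, hF⟩ := hF
  simp_rw [hF, Finset.mul_sum]
  exact memLp_finsetSum _ fun k _ => memLp_fockWeight_mul_bargmann σ hσ k (hφ k)

/-- For `j = 0` the function is a multiple of `z^m`, and each increase of `j` is twice a derivative.
-/
theorem exists_polynomial_bargmannHolo (σ : ℝ) (hσ : 0 < σ) (j m : ℕ) :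
    ∃ Q : Polynomial ℂ, ∀ z,
      bargmannHolo σ j (fun t => (hermiteFunction σ m t : ℂ)) z = Q.eval z := by
  induction j with
  | zero =>
    refine ⟨Polynomial.C ((Real.pi / σ : ℂ) ^ (1 / 2 : ℂ) * σ ^ m) * Polynomial.X ^ m,
      fun z => ?_⟩
    rw [← bargmann_zero, bargmann_zero_hermiteFunction σ hσ]
    simp [mul_pow, mul_assoc]
  | succ j ih =>
    obtain ⟨Q, hQ⟩ := ih
    refine ⟨Polynomial.C 2 * Q.derivative, fun z => ?_⟩
    have h := hasDerivAt_bargmannHolo σ hσ j (memLp_hermiteFunction σ hσ m) z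
    rw [funext hQ] at h
    have := h.unique (Q.hasDerivAt z)
    rw [Polynomial.eval_mul, Polynomial.eval_C, ← this]
    ring

/-- The transform of level `b` of `h_a` is a nonzero multiple of `z^a z̄^b` plus terms of lower
degree in `z̄` with polynomial coefficients. Those are sums of monomials covered by strong induction
on `b`, so the top term can be solved for. -/
theorem isBargmannSum_monomial (σ : ℝ) (hσ : 0 < σ) (b a : ℕ) :
    IsBargmannSum σ (b + 1) (fun z => z ^ a * (starRingEnd ℂ) z ^ b) := by
  induction b using Nat.strong_induction_on generalizing a with
  | _ b ih =>
    have hm := memLp_hermiteFunction σ hσ a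
    have hσ0 : (σ : ℂ) ≠ 0 := by exact_mod_cast hσ.ne'
    have hpi : (Real.pi / σ : ℂ) ^ (1 / 2 : ℂ) ≠ 0 := by
      rw [Ne, Complex.cpow_eq_zero_iff]
      have : (Real.pi / σ : ℂ) ≠ 0 := div_ne_zero (by exact_mod_cast Real.pi_ne_zero) hσ0
      tauto
    choose Q hQ using fun j => exists_polynomial_bargmannHolo σ hσ j a
    have hlow : IsBargmannSum σ (b + 1) (fun z => ∑ k ∈ Finset.range b,
        (starRingEnd ℂ) z ^ k * ((b.choose k * (-σ) ^ k : ℂ) * (Q (b - k)).eval z)) := by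
      refine IsBargmannSum.sum hσ _ fun k hk => ?_
      have hk := Finset.mem_range.1 hk
      have e : (fun z : ℂ => (starRingEnd ℂ) z ^ k *
          ((b.choose k * (-σ) ^ k : ℂ) * (Q (b - k)).eval z)) = fun z =>
          ∑ i ∈ Finset.range ((Q (b - k)).natDegree + 1),
            ((b.choose k * (-σ) ^ k : ℂ) * (Q (b - k)).coeff i) *
              (z ^ i * (starRingEnd ℂ) z ^ k) := by
        funext z
        rw [Polynomial.eval_eq_sum_range, Finset.mul_sum, Finset.mul_sum]
        exact Finset.sum_congr rfl fun i _ => by ring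
      rw [e]
      exact IsBargmannSum.sum hσ _ fun i _ => ((ih k hk i).mono hσ (by omega)).const_mul _
    have hsum := ((isBargmannSum_bargmann σ (Nat.lt_succ_self b) hm).add hσ
      (hlow.const_mul (-1))).const_mul
      (((-σ : ℂ) ^ b * ((Real.pi / σ : ℂ) ^ (1 / 2 : ℂ) * σ ^ a))⁻¹)
    have e : ∀ z : ℂ, bargmann σ b (fun t => (hermiteFunction σ a t : ℂ)) z +
        -1 * ∑ k ∈ Finset.range b, (starRingEnd ℂ) z ^ k *
          ((b.choose k * (-σ) ^ k : ℂ) * (Q (b - k)).eval z) =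
        ((-σ : ℂ) ^ b * ((Real.pi / σ : ℂ) ^ (1 / 2 : ℂ) * σ ^ a)) *
          (z ^ a * (starRingEnd ℂ) z ^ b) := fun z => by
      rw [bargmann_eq_sum σ hσ b hm, Finset.sum_range_succ]
      simp_rw [hQ]
      rw [← hQ (b - b), Nat.sub_self, ← bargmann_zero, bargmann_zero_hermiteFunction σ hσ,
        Nat.choose_self, mul_pow]
      push_cast
      ring
    simp_rw [e] at hsum
    have hne : ((-σ : ℂ) ^ b * ((Real.pi / σ : ℂ) ^ (1 / 2 : ℂ) * σ ^ a)) ≠ 0 :=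
      mul_ne_zero (pow_ne_zero _ (neg_ne_zero.2 hσ0)) (mul_ne_zero hpi (pow_ne_zero _ hσ0))
    simpa only [inv_mul_cancel_left₀ hne] using hsum

/-! ### Decomposition of the poly-Fock spaces into levels -/

/-- The constants in Moyal's identity. -/
def moyalConst (σ : ℝ) (j k : ℕ) : ℝ :=
  2 * Real.pi / σ * ∫ t, hermiteFunction σ j t * hermiteFunction σ k t

theorem moyalConst_of_ne (σ : ℝ) (hσ : 0 < σ) {j k : ℕ} (h : j ≠ k) : moyalConst σ j k = 0 := by
  rw [moyalConst, integral_hermiteFunction_mul_of_ne σ hσ j k h, mul_zero]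

theorem moyalConst_self_pos (σ : ℝ) (hσ : 0 < σ) (n : ℕ) : 0 < moyalConst σ n n := by
  have := Real.pi_pos
  rw [moyalConst, integral_hermiteFunction_mul_self σ hσ]
  positivity

theorem integral_weighted_bargmann (σ : ℝ) (hσ : 0 < σ) (j k : ℕ) {φ ψ : ℝ → ℂ}
    (hφ : MemLp φ 2) (hψ : MemLp ψ 2) :
    ∫ z : ℂ, ((fockWeight σ z : ℂ) * bargmann σ j φ z) *
      (starRingEnd ℂ) ((fockWeight σ z : ℂ) * bargmann σ k ψ z) =
      moyalConst σ j k * ∫ t : ℝ, φ t * (starRingEnd ℂ) (ψ t) :=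
  integral_waveTransform_mul_conj σ hσ j k hφ hψ

/-- The weighted Bargmann transform between the `L²` spaces, as a linear map. -/
def waveLinear (σ : ℝ) (hσ : 0 < σ) (n : ℕ) :
    Lp ℂ 2 (volume : Measure ℝ) →ₗ[ℂ] Lp ℂ 2 (volume : Measure ℂ) where
  toFun φ := (memLp_waveTransform σ hσ n (Lp.memLp φ)).toLp
  map_add' φ ψ := by
    rw [← MemLp.toLp_add]
    refine MemLp.toLp_congr _ _ (Filter.Eventually.of_forall fun z => ?_)
    rw [Pi.add_apply, waveTransform_eq, waveTransform_eq, waveTransform_eq,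
      bargmann_congr_ae σ n (Lp.coeFn_add φ ψ), ← mul_add,
      ← bargmann_add σ hσ n (Lp.memLp φ) (Lp.memLp ψ)]
    rfl
  map_smul' c φ := by
    rw [RingHom.id_apply, ← MemLp.toLp_const_smul]
    refine MemLp.toLp_congr _ _ (Filter.Eventually.of_forall fun z => ?_)
    rw [Pi.smul_apply, waveTransform_eq, waveTransform_eq,
      bargmann_congr_ae σ n (Lp.coeFn_smul c φ), smul_eq_mul, mul_left_comm,
      ← bargmann_const_mul σ n c]
    rfl

theorem coeFn_waveLinear (σ : ℝ) (hσ : 0 < σ) (n : ℕ) (φ : Lp ℂ 2 (volume : Measure ℝ)) :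
    waveLinear σ hσ n φ =ᵐ[volume] waveTransform σ n φ :=
  (memLp_waveTransform σ hσ n (Lp.memLp φ)).coeFn_toLp

theorem inner_waveLinear (σ : ℝ) (hσ : 0 < σ) (j k : ℕ) (φ ψ : Lp ℂ 2 (volume : Measure ℝ)) :
    inner ℂ (waveLinear σ hσ j φ) (waveLinear σ hσ k ψ) =
      (moyalConst σ k j : ℂ) * inner ℂ φ ψ := by
  rw [L2.inner_def, L2.inner_def]
  simp_rw [RCLike.inner_apply]
  rw [moyalConst, ← integral_waveTransform_mul_conj σ hσ k j (Lp.memLp ψ) (Lp.memLp φ)]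
  refine integral_congr_ae ?_
  filter_upwards [coeFn_waveLinear σ hσ j φ, coeFn_waveLinear σ hσ k ψ] with z h1 h2
  rw [h1, h2]

theorem norm_waveLinear_sq (σ : ℝ) (hσ : 0 < σ) (n : ℕ) (φ : Lp ℂ 2 (volume : Measure ℝ)) :
    ‖waveLinear σ hσ n φ‖ ^ 2 = moyalConst σ n n * ‖φ‖ ^ 2 := by
  have h := inner_waveLinear σ hσ n n φ φ
  rw [inner_self_eq_norm_sq_to_K, inner_self_eq_norm_sq_to_K] at h
  apply Complex.ofReal_injective
  push_cast
  exact h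

/-- The weighted Bargmann transform between the `L²` spaces, as a continuous linear map. -/
def waveCLM (σ : ℝ) (hσ : 0 < σ) (n : ℕ) :
    Lp ℂ 2 (volume : Measure ℝ) →L[ℂ] Lp ℂ 2 (volume : Measure ℂ) :=
  (waveLinear σ hσ n).mkContinuous (Real.sqrt (moyalConst σ n n)) fun φ => by
    refine le_of_sq_le_sq ?_ (by positivity)
    rw [norm_waveLinear_sq, mul_pow, Real.sq_sqrt (moyalConst_self_pos σ hσ n).le]

/-- Every polyanalytic Fock function is a sum of Bargmann transforms. -/
theorem isBargmannSum_of_mem_polyFock (σ : ℝ) (hσ : 0 < σ) {N : ℕ} {G : ℂ → ℂ}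
    (hG : G ∈ polyFock (σ / 2) N) : IsBargmannSum σ N G := by
  obtain ⟨hpoly, hmem⟩ := (mem_polyFock_iff σ N G).1 hG
  set A := waveCLM σ hσ with hA
  -- By Moyal's identity `A_k* A_k` is the scalar `moyalConst σ k k`, so `A_k (φ k)` is the
  -- orthogonal projection of the weighted `G` onto the range of `A_k`.
  set φ : ℕ → Lp ℂ 2 (volume : Measure ℝ) := fun k =>
    ((moyalConst σ k k : ℂ)⁻¹) • (ContinuousLinearMap.adjoint (A k)) hmem.toLp with hφ
  have hD : IsBargmannSum σ N (fun z => ∑ k ∈ Finset.range N, bargmann σ k (φ k) z) :=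
    ⟨fun k => φ k, fun k => Lp.memLp (φ k), fun z => rfl⟩
  set G' : ℂ → ℂ := fun z => G z + -1 * ∑ k ∈ Finset.range N, bargmann σ k (φ k) z with hG'
  have hG'p : IsPolyanalytic N G' := hpoly.add ((hD.const_mul (-1)).isPolyanalytic hσ)
  have hG'm : MemLp (fun z => (fockWeight σ z : ℂ) * G' z) 2 := by
    have := hmem.add ((hD.const_mul (-1)).memLp hσ)
    refine this.ae_eq (Filter.Eventually.of_forall fun z => ?_)
    simp only [Pi.add_apply, hG']
    ring
  have hclass : hG'm.toLp = hmem.toLp - ∑ k ∈ Finset.range N, A k (φ k) := by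
    have hsum : (∑ k ∈ Finset.range N, A k (φ k)) = (hD.memLp hσ).toLp := by
      refine Lp.ext ?_
      have hall : ∀ᵐ z, ∀ k, A k (φ k) z = waveTransform σ k (φ k) z :=
        ae_all_iff.2 fun k => coeFn_waveLinear σ hσ k (φ k)
      filter_upwards [hall, (hD.memLp hσ).coeFn_toLp,
        Lp.coeFn_finsetSum (Finset.range N) (fun k => A k (φ k))] with z h1 h2 h3
      rw [h2, h3, Finset.sum_apply, Finset.mul_sum]
      exact Finset.sum_congr rfl fun k _ => h1 k
    rw [hsum, ← MemLp.toLp_sub]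
    refine MemLp.toLp_congr _ _ (Filter.Eventually.of_forall fun z => ?_)
    simp only [Pi.sub_apply, hG']
    ring
  -- Levels are mutually orthogonal, so only the summand `k = j` survives, and it cancels the
  -- pairing with `G` by the definition of the adjoint.
  have hperp : ∀ j < N, ∀ ψ : Lp ℂ 2 (volume : Measure ℝ), inner ℂ (A j ψ) hG'm.toLp = 0 := by
    intro j hj ψ
    rw [hclass, inner_sub_right, inner_sum, Finset.sum_eq_single_of_mem j (Finset.mem_range.2 hj)]
    · have h1 : inner ℂ (A j ψ) (A j (φ j)) = (moyalConst σ j j : ℂ) * inner ℂ ψ (φ j) :=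
        inner_waveLinear σ hσ j j ψ (φ j)
      have hne : (moyalConst σ j j : ℂ) ≠ 0 := by
        exact_mod_cast (moyalConst_self_pos σ hσ j).ne'
      rw [h1, hφ]
      simp only
      rw [inner_smul_right, mul_inv_cancel_left₀ hne, ContinuousLinearMap.adjoint_inner_right,
        sub_self]
    · intro k _ hk
      have h1 : inner ℂ (A j ψ) (A k (φ k)) = (moyalConst σ k j : ℂ) * inner ℂ ψ (φ k) :=
        inner_waveLinear σ hσ j k ψ (φ k)
      rw [h1, moyalConst_of_ne σ hσ hk]
      simp
  have hperp' : ∀ j < N, ∀ ψ : ℝ → ℂ, MemLp ψ 2 → ∫ z : ℂ, ((fockWeight σ z : ℂ) * G' z) *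
      (starRingEnd ℂ) ((fockWeight σ z : ℂ) * bargmann σ j ψ z) = 0 := by
    intro j hj ψ hψ
    rw [← hperp j hj hψ.toLp, L2.inner_def]
    refine integral_congr_ae ?_
    have h1 : A j hψ.toLp =ᵐ[volume] waveTransform σ j hψ.toLp := coeFn_waveLinear σ hσ j _
    filter_upwards [h1, hG'm.coeFn_toLp] with z h1 h2
    rw [h1, h2, RCLike.inner_apply, waveTransform_eq, bargmann_congr_ae σ j hψ.coeFn_toLp]
  have hzero : ∀ z, G' z = 0 := by
    refine eq_zero_of_orthogonal_monomials hG'p (continuous_fockWeight σ) (fockWeight_pos σ)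
      (fun u z hu => by simp [fockWeight, hu]) hG'm
      (fun a b => (isBargmannSum_monomial σ hσ b a).memLp hσ) fun a b hb => ?_
    obtain ⟨ψ, hψ, e⟩ := isBargmannSum_monomial σ hσ b a
    simp_rw [e, Finset.mul_sum, map_sum, Finset.mul_sum]
    rw [integral_finsetSum]
    · refine Finset.sum_eq_zero fun k hk => ?_
      have := Finset.mem_range.1 hk
      exact hperp' k (by omega) _ (hψ k)
    · intro k _
      exact hG'm.integrable_mul (memLp_fockWeight_mul_bargmann σ hσ k (hψ k)).star
  refine ⟨fun k => φ k, fun k => Lp.memLp (φ k), fun z => ?_⟩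
  have := hzero z
  simp only [hG'] at this
  linear_combination this

/-- Every summand of `G` has level below `n`, so its Moyal constant with level `n` is zero. -/
theorem integral_bargmann_mul_conj_isBargmannSum (σ : ℝ) (hσ : 0 < σ) {n : ℕ} {φ : ℝ → ℂ}
    (hφ : MemLp φ 2) {G : ℂ → ℂ} (hG : IsBargmannSum σ n G) :
    ∫ z : ℂ, ((fockWeight σ z : ℂ) * bargmann σ n φ z) *
      (starRingEnd ℂ) ((fockWeight σ z : ℂ) * G z) = 0 := by
  obtain ⟨ψ, hψ, e⟩ := hG
  simp_rw [e, Finset.mul_sum, map_sum, Finset.mul_sum]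
  rw [integral_finsetSum]
  · refine Finset.sum_eq_zero fun k hk => ?_
    rw [integral_weighted_bargmann σ hσ n k hφ (hψ k),
      moyalConst_of_ne σ hσ (Finset.mem_range.1 hk).ne']
    simp
  · intro k _
    exact (memLp_fockWeight_mul_bargmann σ hσ n hφ).integrable_mul
      (memLp_fockWeight_mul_bargmann σ hσ k (hψ k)).star

theorem bargmann_mem_truePolyFock (σ : ℝ) (hσ : 0 < σ) (n : ℕ) {φ : ℝ → ℂ} (hφ : MemLp φ 2) :
    bargmann σ n φ ∈ truePolyFock (σ / 2) n := by
  refine ⟨(mem_polyFock_iff σ _ _).2 ⟨isPolyanalytic_bargmann σ hσ n hφ,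
    memLp_fockWeight_mul_bargmann σ hσ n hφ⟩, fun G hG => ?_⟩
  simp_rw [weighted_integrand_eq]
  exact integral_bargmann_mul_conj_isBargmannSum σ hσ hφ (isBargmannSum_of_mem_polyFock σ hσ hG)

/-- The Bargmann transform of level `n` is onto the true-poly-Fock space of level `n`. -/
theorem exists_bargmann_eq_of_mem_truePolyFock (σ : ℝ) (hσ : 0 < σ) (n : ℕ) {F : ℂ → ℂ}
    (hF : F ∈ truePolyFock (σ / 2) n) : ∃ φ : ℝ → ℂ, MemLp φ 2 ∧ F = bargmann σ n φ := by
  obtain ⟨hF1, hF2⟩ := hF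
  obtain ⟨φ, hφ, e⟩ := isBargmannSum_of_mem_polyFock σ hσ hF1
  have hD : IsBargmannSum σ n (fun z => ∑ k ∈ Finset.range n, bargmann σ k (φ k) z) :=
    ⟨φ, hφ, fun _ => rfl⟩
  set D : ℂ → ℂ := fun z => ∑ k ∈ Finset.range n, bargmann σ k (φ k) z with hDdef
  have hFD : ∀ z, F z = D z + bargmann σ n (φ n) z := fun z => by
    rw [e, Finset.sum_range_succ]
  -- `F` is tested against its own lower part `D`. The top level is orthogonal to `D`, so what
  -- remains is the squared norm of `D`, which must vanish.
  have h1 := hF2 D ((mem_polyFock_iff σ n D).2 ⟨hD.isPolyanalytic hσ, hD.memLp hσ⟩)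
  simp_rw [weighted_integrand_eq, hFD, mul_add, add_mul] at h1
  have hDm := hD.memLp hσ
  have hi1 : Integrable fun z => ((fockWeight σ z : ℂ) * D z) *
      (starRingEnd ℂ) ((fockWeight σ z : ℂ) * D z) := hDm.integrable_mul hDm.star
  have hi2 : Integrable fun z => ((fockWeight σ z : ℂ) * bargmann σ n (φ n) z) *
      (starRingEnd ℂ) ((fockWeight σ z : ℂ) * D z) :=
    (memLp_fockWeight_mul_bargmann σ hσ n (hφ n)).integrable_mul hDm.star
  rw [integral_add hi1 hi2, integral_bargmann_mul_conj_isBargmannSum σ hσ (hφ n) hD, add_zero] at h1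
  have e2 : ∀ w : ℂ, w * (starRingEnd ℂ) w = ((‖w‖ ^ 2 : ℝ) : ℂ) := fun w => by
    rw [Complex.mul_conj, Complex.normSq_eq_norm_sq]
  simp_rw [e2] at h1
  rw [integral_complex_ofReal] at h1
  have h0 : ∫ z : ℂ, ‖(fockWeight σ z : ℂ) * D z‖ ^ 2 = 0 := by exact_mod_cast h1
  rw [integral_eq_zero_iff_of_nonneg (fun z => by positivity)
    ((memLp_two_iff_integrable_sq_norm hDm.aestronglyMeasurable).1 hDm)] at h0
  have hDc : Continuous D := (hD.isPolyanalytic hσ).contDiff.continuous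
  have hcn : Continuous fun z : ℂ => ‖(fockWeight σ z : ℂ) * D z‖ ^ 2 := by
    have := continuous_fockWeight σ
    fun_prop
  refine ⟨φ n, hφ n, funext fun z => ?_⟩
  have h2 : ‖(fockWeight σ z : ℂ) * D z‖ ^ 2 = 0 :=
    congrFun ((hcn.ae_eq_iff_eq volume continuous_const).1 h0) z
  have h3 : D z = 0 := by simpa [(fockWeight_pos σ z).ne'] using h2
  rw [hFD, h3, zero_add]

/-! ### Idempotent components of bicomplex numbers and integrals -/

section

theorem plus_add (Z W : Bicomplex) : plus (Z + W) = plus Z + plus W := by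
  simp only [plus, QuadraticAlgebra.re_add, QuadraticAlgebra.im_add]; ring

theorem minus_add (Z W : Bicomplex) : minus (Z + W) = minus Z + minus W := by
  simp only [minus, QuadraticAlgebra.re_add, QuadraticAlgebra.im_add]; ring

theorem plus_mul (Z W : Bicomplex) : plus (Z * W) = plus Z * plus W := by
  simp only [plus, QuadraticAlgebra.re_mul, QuadraticAlgebra.im_mul]
  linear_combination (-(Z.im * W.im)) * Complex.I_sq

theorem minus_mul (Z W : Bicomplex) : minus (Z * W) = minus Z * minus W := by
  simp only [minus, QuadraticAlgebra.re_mul, QuadraticAlgebra.im_mul]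
  linear_combination (-(Z.im * W.im)) * Complex.I_sq

theorem plus_smul (c : ℂ) (Z : Bicomplex) : plus (c • Z) = c * plus Z := by
  simp only [plus, QuadraticAlgebra.re_smul, QuadraticAlgebra.im_smul, smul_eq_mul]; ring

theorem minus_smul (c : ℂ) (Z : Bicomplex) : minus (c • Z) = c * minus Z := by
  simp only [minus, QuadraticAlgebra.re_smul, QuadraticAlgebra.im_smul, smul_eq_mul]; ring

theorem plus_real_smul (c : ℝ) (Z : Bicomplex) : plus (c • Z) = c * plus Z := by
  simp only [plus, QuadraticAlgebra.re_smul, QuadraticAlgebra.im_smul, Complex.real_smul]; ring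

theorem minus_real_smul (c : ℝ) (Z : Bicomplex) : minus (c • Z) = c * minus Z := by
  simp only [minus, QuadraticAlgebra.re_smul, QuadraticAlgebra.im_smul, Complex.real_smul]; ring

theorem plus_sub (Z W : Bicomplex) : plus (Z - W) = plus Z - plus W := by
  simp only [plus, QuadraticAlgebra.re_sub, QuadraticAlgebra.im_sub]; ring

theorem minus_sub (Z W : Bicomplex) : minus (Z - W) = minus Z - minus W := by
  simp only [minus, QuadraticAlgebra.re_sub, QuadraticAlgebra.im_sub]; ring

theorem plus_neg (Z : Bicomplex) : plus (-Z) = -plus Z := by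
  simp only [plus, QuadraticAlgebra.re_neg, QuadraticAlgebra.im_neg]; ring

theorem minus_neg (Z : Bicomplex) : minus (-Z) = -minus Z := by
  simp only [minus, QuadraticAlgebra.re_neg, QuadraticAlgebra.im_neg]; ring

theorem plus_ePlus : plus ePlus = 1 := by
  simp only [plus, ePlus]
  linear_combination (-(1 / 2)) * Complex.I_sq

theorem minus_ePlus : minus ePlus = 0 := by
  simp only [minus, ePlus]
  linear_combination (1 / 2) * Complex.I_sq

theorem plus_eMinus : plus eMinus = 0 := by
  simp only [plus, eMinus]
  linear_combination (1 / 2) * Complex.I_sq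

theorem minus_eMinus : minus eMinus = 1 := by
  simp only [minus, eMinus]
  linear_combination (-(1 / 2)) * Complex.I_sq

theorem plus_ofReal (t : ℝ) : plus (ofReal t) = t := by simp [plus, ofReal]

theorem minus_ofReal (t : ℝ) : minus (ofReal t) = t := by simp [minus, ofReal]

theorem plus_conj (Z : Bicomplex) : plus (conj Z) = (starRingEnd ℂ) (plus Z) := by
  simp [plus, conj]

theorem minus_conj (Z : Bicomplex) : minus (conj Z) = (starRingEnd ℂ) (minus Z) := by
  simp [minus, conj]

theorem plus_dagger (Z : Bicomplex) : plus (dagger Z) = minus Z := by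
  simp [plus, minus, dagger]

theorem minus_dagger (Z : Bicomplex) : minus (dagger Z) = plus Z := by
  simp [plus, minus, dagger, sub_eq_add_neg]

theorem plus_exp (Z : Bicomplex) : plus (exp Z) = Complex.exp (plus Z) := by
  simp only [plus, exp]
  rw [show Z.re - Complex.I * Z.im = Z.re + (-Z.im) * Complex.I by ring, Complex.exp_add,
    Complex.exp_mul_I, Complex.cos_neg, Complex.sin_neg]
  ring

theorem minus_exp (Z : Bicomplex) : minus (exp Z) = Complex.exp (minus Z) := by
  simp only [minus, exp]
  rw [mul_comm Complex.I Z.im, Complex.exp_add, Complex.exp_mul_I]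
  ring

theorem ext_plus_minus {Z W : Bicomplex} (h1 : plus Z = plus W) (h2 : minus Z = minus W) :
    Z = W := by
  rw [idempotent_decomposition Z, idempotent_decomposition W, h1, h2]

/-- The idempotents are orthogonal with squared norm 1/2. This is why `e^{-σ|Z^e|²/2}` splits into
two factors `fockWeight`, each with exponent `σ/4`. -/
theorem norm_sq_eq_plus_minus (Z : Bicomplex) :
    ‖Z‖ ^ 2 = (‖plus Z‖ ^ 2 + ‖minus Z‖ ^ 2) / 2 := by
  rw [norm_sq_eq]
  simp only [← Complex.normSq_eq_norm_sq, Complex.normSq_apply, plus, minus]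
  simp
  ring

/-- The component `Z⁺` as a continuous linear map. -/
def plusL : Bicomplex →L[ℂ] ℂ :=
  LinearMap.toContinuousLinearMap
    { toFun := plus, map_add' := plus_add, map_smul' := plus_smul }

/-- The component `Z⁻` as a continuous linear map. -/
def minusL : Bicomplex →L[ℂ] ℂ :=
  LinearMap.toContinuousLinearMap
    { toFun := minus, map_add' := minus_add, map_smul' := minus_smul }

/-- The component `z₁` as a continuous linear map. -/
def reL : Bicomplex →L[ℂ] ℂ :=
  LinearMap.toContinuousLinearMap
    { toFun := fun Z => Z.re, map_add' := fun _ _ => rfl, map_smul' := fun _ _ => rfl }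

variable {X : Type*} [MeasurableSpace X] {m : Measure X}

theorem plus_integral {f : X → Bicomplex} (hf : Integrable f m) :
    plus (∫ x, f x ∂m) = ∫ x, plus (f x) ∂m :=
  (plusL.integral_comp_comm hf).symm

theorem minus_integral {f : X → Bicomplex} (hf : Integrable f m) :
    minus (∫ x, f x ∂m) = ∫ x, minus (f x) ∂m :=
  (minusL.integral_comp_comm hf).symm

theorem memLp_plus {f : X → Bicomplex} {p : ℝ≥0∞} (hf : MemLp f p m) :
    MemLp (fun x => plus (f x)) p m :=
  plusL.comp_memLp' hf

theorem memLp_minus {f : X → Bicomplex} {p : ℝ≥0∞} (hf : MemLp f p m) :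
    MemLp (fun x => minus (f x)) p m :=
  minusL.comp_memLp' hf

theorem memLp_smul_add_smul {F G : X → ℂ} {p : ℝ≥0∞} (hF : MemLp F p m) (hG : MemLp G p m) :
    MemLp (fun x => F x • ePlus + G x • eMinus) p m :=
  (((ContinuousLinearMap.id ℂ ℂ).smulRight ePlus).comp_memLp' hF).add
    (((ContinuousLinearMap.id ℂ ℂ).smulRight eMinus).comp_memLp' hG)

theorem memLp_of_plus_minus {f : X → Bicomplex} {p : ℝ≥0∞} (h1 : MemLp (fun x => plus (f x)) p m)
    (h2 : MemLp (fun x => minus (f x)) p m) : MemLp f p m :=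
  (memLp_smul_add_smul h1 h2).ae_eq
    (Filter.Eventually.of_forall fun x => (idempotent_decomposition (f x)).symm)

theorem integrable_of_plus_minus {f : X → Bicomplex} (h1 : Integrable (fun x => plus (f x)) m)
    (h2 : Integrable (fun x => minus (f x)) m) : Integrable f m :=
  memLp_one_iff_integrable.1 (memLp_of_plus_minus (memLp_one_iff_integrable.2 h1)
    (memLp_one_iff_integrable.2 h2))

theorem integrable_mul_conj {f g : X → Bicomplex} (hf : MemLp f 2 m) (hg : MemLp g 2 m) :
    Integrable (fun x => f x * conj (g x)) m := by
  refine integrable_of_plus_minus ?_ ?_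
  · simp_rw [plus_mul, plus_conj]
    exact (memLp_plus hf).integrable_mul (memLp_plus hg).star
  · simp_rw [minus_mul, minus_conj]
    exact (memLp_minus hf).integrable_mul (memLp_minus hg).star

theorem plus_scalarProduct {f g : X → Bicomplex} (hf : MemLp f 2 m) (hg : MemLp g 2 m) :
    plus (scalarProduct m f g) = ∫ x, plus (f x) * (starRingEnd ℂ) (plus (g x)) ∂m := by
  rw [scalarProduct, plus_integral (integrable_mul_conj hf hg)]
  simp_rw [plus_mul, plus_conj]

theorem minus_scalarProduct {f g : X → Bicomplex} (hf : MemLp f 2 m) (hg : MemLp g 2 m) :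
    minus (scalarProduct m f g) = ∫ x, minus (f x) * (starRingEnd ℂ) (minus (g x)) ∂m := by
  rw [scalarProduct, minus_integral (integrable_mul_conj hf hg)]
  simp_rw [minus_mul, minus_conj]

/-- The first component of `Z Z*` is `|z₁|² + |z₂|²`, so preservation of the bicomplex scalar
product entails preservation of the norm. -/
theorem re_scalarProduct_self {f : X → Bicomplex} (hf : MemLp f 2 m) :
    (scalarProduct m f f).re = ((∫ x, ‖f x‖ ^ 2 ∂m : ℝ) : ℂ) := by
  rw [← integral_complex_ofReal]
  have h := (reL.integral_comp_comm (integrable_mul_conj hf hf)).symm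
  refine h.trans (integral_congr_ae (Filter.Eventually.of_forall fun x => ?_))
  change (f x * conj (f x)).re = ((‖f x‖ ^ 2 : ℝ) : ℂ)
  rw [norm_sq_eq, QuadraticAlgebra.re_mul, conj]
  simp only [← Complex.normSq_eq_norm_sq]
  push_cast
  rw [← Complex.mul_conj, ← Complex.mul_conj]
  ring

theorem eLpNorm_two_eq_of_scalarProduct_eq {Y : Type*} [MeasurableSpace Y] {m' : Measure Y}
    {f : X → Bicomplex} {g : Y → Bicomplex} (hf : MemLp f 2 m) (hg : MemLp g 2 m')
    (h : scalarProduct m f f = scalarProduct m' g g) : eLpNorm f 2 m = eLpNorm g 2 m' := by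
  have h1 : ∫ x, ‖f x‖ ^ 2 ∂m = ∫ y, ‖g y‖ ^ 2 ∂m' := by
    have := congrArg QuadraticAlgebra.re h
    rw [re_scalarProduct_self hf, re_scalarProduct_self hg] at this
    exact_mod_cast this
  rw [hf.eLpNorm_eq_integral_rpow_norm two_ne_zero ENNReal.ofNat_ne_top,
    hg.eLpNorm_eq_integral_rpow_norm two_ne_zero ENNReal.ofNat_ne_top]
  simp only [ENNReal.toReal_ofNat, Real.rpow_two]
  rw [h1]

theorem eq_I_or_neg_I {w : ℂ} (h : w ^ 2 = -1) : w = Complex.I ∨ w = -Complex.I := by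
  rw [← sq_eq_sq_iff_eq_or_eq_neg, Complex.I_sq, h]

theorem plus_sq_eq {ν : Bicomplex} (hν : ν ^ 2 = -1) : plus ν ^ 2 = -1 := by
  have := congrArg plus hν
  rw [sq, plus_mul, ← sq] at this
  rw [this, plus_neg, plus, QuadraticAlgebra.re_one, QuadraticAlgebra.im_one]
  simp

theorem minus_sq_eq {ν : Bicomplex} (hν : ν ^ 2 = -1) : minus ν ^ 2 = -1 := by
  have := congrArg minus hν
  rw [sq, minus_mul, ← sq] at this
  rw [this, minus_neg, minus, QuadraticAlgebra.re_one, QuadraticAlgebra.im_one]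
  simp

/-! ### The companion variables -/

/-- The real linear map `x + iy ↦ x + wy` for `w² = -1`. -/
def twist (w z : ℂ) : ℂ := z.re + w * z.im

theorem twist_re {w : ℂ} (h : w ^ 2 = -1) (z : ℂ) : (twist w z).re = z.re := by
  rcases eq_I_or_neg_I h with rfl | rfl <;> simp [twist]

theorem twist_im_mul {w : ℂ} (h : w ^ 2 = -1) (z : ℂ) :
    Complex.I * (twist w z).im = w * z.im := by
  rcases eq_I_or_neg_I h with rfl | rfl <;> simp [twist]

theorem norm_twist_sq {w : ℂ} (h : w ^ 2 = -1) (z : ℂ) :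
    ‖twist w z‖ ^ 2 = z.re ^ 2 + z.im ^ 2 := by
  rw [← Complex.normSq_eq_norm_sq, Complex.normSq_apply]
  rcases eq_I_or_neg_I h with rfl | rfl <;> simp [twist] <;> ring

/-- For `w = i` the map is the identity, for `w = -i` it is complex conjugation. -/
theorem measurePreserving_twist {w : ℂ} (h : w ^ 2 = -1) : MeasurePreserving (twist w) := by
  rcases eq_I_or_neg_I h with rfl | rfl
  · have : twist Complex.I = id := by
      funext z
      rw [twist, mul_comm, Complex.re_add_im, id]
    rw [this]
    exact MeasurePreserving.id _
  · have : twist (-Complex.I) = Complex.conjLIE := by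
      funext z
      apply Complex.ext <;> simp [twist]
    rw [this]
    exact Complex.conjLIE.measurePreserving

theorem plus_companion (ν μ Z : Bicomplex) : plus (companion ν μ Z) = twist (plus ν) Z.re := by
  simp only [companion, plus_add, plus_mul, plus_ePlus, plus_eMinus, plus_ofReal, twist]
  ring

theorem minus_companion (ν μ Z : Bicomplex) : minus (companion ν μ Z) = twist (minus μ) Z.im := by
  simp only [companion, minus_add, minus_mul, minus_ePlus, minus_eMinus, minus_ofReal, twist]
  ring

/-- The components of the companion variable. -/
def companionPair (ν μ Z : Bicomplex) : ℂ × ℂ := (twist (plus ν) Z.re, twist (minus μ) Z.im)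

theorem measurePreserving_companionPair {ν μ : Bicomplex} (hν : ν ^ 2 = -1) (hμ : μ ^ 2 = -1) :
    MeasurePreserving (companionPair ν μ) measure ((4 : ℝ≥0∞)⁻¹ • volume) := by
  have ht := (measurePreserving_twist (plus_sq_eq hν)).prod (measurePreserving_twist (minus_sq_eq hμ))
  have hm1 : Measurable (fun Z : Bicomplex => Z.re) := reL.continuous.measurable
  have hm2 : Measurable (fun Z : Bicomplex => Z.im) := by
    let imL : Bicomplex →L[ℂ] ℂ := LinearMap.toContinuousLinearMap
      { toFun := fun Z => Z.im, map_add' := fun _ _ => rfl, map_smul' := fun _ _ => rfl }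
    exact imL.continuous.measurable
  have hm : Measurable (companionPair ν μ) :=
    ((measurePreserving_twist (plus_sq_eq hν)).measurable.comp hm1).prodMk
      ((measurePreserving_twist (minus_sq_eq hμ)).measurable.comp hm2)
  refine ⟨hm, ?_⟩
  rw [measure, Measure.map_smul, Measure.map_map hm measurable_mk]
  congr 1
  exact ht.map_eq

/-- The functions making up the companion spaces, in the companion variables. -/
def pairFun (σ : ℝ) (F G : ℂ → ℂ) (p : ℂ × ℂ) : Bicomplex :=
  (fockWeight σ p.1 * fockWeight σ p.2) • (F p.1 • ePlus + G p.2 • eMinus)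

theorem mem_trueCompanionSpace_iff (σ : ℝ) (ν μ : Bicomplex) (n : ℕ) (Υ : Bicomplex → Bicomplex) :
    Υ ∈ trueCompanionSpace σ ν μ n ↔ ∃ F ∈ truePolyFock (σ / 2) n, ∃ G ∈ truePolyFock (σ / 2) n,
      Υ = pairFun σ F G ∘ companionPair ν μ := by
  have e : ∀ F G : ℂ → ℂ, ∀ Z, Real.exp (-(σ / 2) * ‖companion ν μ Z‖ ^ 2) •
      (F (plus (companion ν μ Z)) • ePlus + G (minus (companion ν μ Z)) • eMinus) =
      (pairFun σ F G ∘ companionPair ν μ) Z := fun F G Z => by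
    rw [norm_sq_eq_plus_minus, plus_companion, minus_companion, Function.comp_apply, pairFun,
      companionPair, fockWeight, fockWeight, ← Real.exp_add]
    congr 2
    ring
  constructor
  · rintro ⟨F, hF, G, hG, h⟩
    exact ⟨F, hF, G, hG, funext fun Z => (h Z).trans (e F G Z)⟩
  · rintro ⟨F, hF, G, hG, h⟩
    exact ⟨F, hF, G, hG, fun Z => by rw [h, e]⟩

theorem plus_pairFun (σ : ℝ) (F G : ℂ → ℂ) (p : ℂ × ℂ) :
    plus (pairFun σ F G p) = ((fockWeight σ p.1 : ℂ) * F p.1) * fockWeight σ p.2 := by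
  simp only [pairFun, plus_real_smul, plus_add, plus_smul, plus_ePlus, plus_eMinus]
  push_cast
  ring

theorem minus_pairFun (σ : ℝ) (F G : ℂ → ℂ) (p : ℂ × ℂ) :
    minus (pairFun σ F G p) = (fockWeight σ p.1 : ℂ) * ((fockWeight σ p.2 : ℂ) * G p.2) := by
  simp only [pairFun, minus_real_smul, minus_add, minus_smul, minus_ePlus, minus_eMinus]
  push_cast
  ring

theorem memLp_fockWeight (σ : ℝ) (hσ : 0 < σ) : MemLp (fun z => (fockWeight σ z : ℂ)) 2 := by
  -- The constant 1 is the monomial with both exponents 0.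
  have := (isBargmannSum_monomial σ hσ 0 0).memLp hσ
  simpa using this

theorem memLp_mul_prod {F G : ℂ → ℂ} (hF : MemLp F 2) (hG : MemLp G 2) :
    MemLp (fun p : ℂ × ℂ => F p.1 * G p.2) 2 := by
  have hm : AEStronglyMeasurable (fun p : ℂ × ℂ => F p.1 * G p.2)
      ((volume : Measure ℂ).prod volume) :=
    hF.aestronglyMeasurable.comp_fst.mul hG.aestronglyMeasurable.comp_snd
  refine (memLp_two_iff_integrable_sq_norm hm).2 ?_
  have h1 := (memLp_two_iff_integrable_sq_norm hF.aestronglyMeasurable).1 hF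
  have h2 := (memLp_two_iff_integrable_sq_norm hG.aestronglyMeasurable).1 hG
  refine (h1.mul_prod h2).congr (Filter.Eventually.of_forall fun p => ?_)
  simp only [norm_mul, mul_pow]

theorem integral_fockWeight_mul_conj (σ : ℝ) (hσ : 0 < σ) :
    ∫ z : ℂ, (fockWeight σ z : ℂ) * (starRingEnd ℂ) (fockWeight σ z : ℂ) =
      ((2 * Real.pi / σ : ℝ) : ℂ) := by
  have e : ∀ z : ℂ, (fockWeight σ z : ℂ) * (starRingEnd ℂ) (fockWeight σ z : ℂ) =
      ((Real.exp (-(σ / 2) * ‖z‖ ^ 2) : ℝ) : ℂ) := fun z => by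
    rw [Complex.conj_ofReal, ← fockWeight_mul_self]; push_cast; ring
  simp_rw [e]
  rw [integral_complex_ofReal, GaussianFourier.integral_rexp_neg_mul_sq_norm (half_pos hσ)]
  congr 1
  rw [Complex.finrank_real_complex]
  simp
  field_simp

theorem memLp_pairFun (σ : ℝ) (hσ : 0 < σ) {F G : ℂ → ℂ}
    (hF : MemLp (fun z => (fockWeight σ z : ℂ) * F z) 2)
    (hG : MemLp (fun z => (fockWeight σ z : ℂ) * G z) 2) :
    MemLp (pairFun σ F G) 2 ((4 : ℝ≥0∞)⁻¹ • volume) := by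
  refine MemLp.smul_measure (memLp_of_plus_minus ?_ ?_) (by simp)
  · simp_rw [plus_pairFun]
    exact memLp_mul_prod hF (memLp_fockWeight σ hσ)
  · simp_rw [minus_pairFun]
    exact memLp_mul_prod (memLp_fockWeight σ hσ) hG

theorem memLp_pairFun_comp {σ : ℝ} (hσ : 0 < σ) {ν μ : Bicomplex} (hν : ν ^ 2 = -1)
    (hμ : μ ^ 2 = -1) {F G : ℂ → ℂ}
    (hF : MemLp (fun z => (fockWeight σ z : ℂ) * F z) 2)
    (hG : MemLp (fun z => (fockWeight σ z : ℂ) * G z) 2) :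
    MemLp (pairFun σ F G ∘ companionPair ν μ) 2 measure :=
  (memLp_pairFun σ hσ hF hG).comp_measurePreserving (measurePreserving_companionPair hν hμ)

theorem scalarProduct_comp {Y : Type*} [MeasurableSpace Y] {m' : Measure Y} {θ : X → Y}
    (hθ : MeasurePreserving θ m m') {f g : Y → Bicomplex} (hf : MemLp f 2 m') (hg : MemLp g 2 m') :
    scalarProduct m (f ∘ θ) (g ∘ θ) = scalarProduct m' f g := by
  have h := integrable_mul_conj hf hg
  rw [scalarProduct, scalarProduct, ← hθ.map_eq, integral_map hθ.measurable.aemeasurable]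
  · rfl
  · rw [hθ.map_eq]; exact h.aestronglyMeasurable

/-- In each component the integrand is a product. The variable not seen by `F` or `G` contributes
the Gaussian mass `2π/σ`, and the factor 1/4 of the measure turns it into `π/(2σ)`. -/
theorem scalarProduct_pairFun_comp {σ : ℝ} (hσ : 0 < σ) {ν μ : Bicomplex} (hν : ν ^ 2 = -1)
    (hμ : μ ^ 2 = -1) {F G F' G' : ℂ → ℂ}
    (hF : MemLp (fun z => (fockWeight σ z : ℂ) * F z) 2)
    (hG : MemLp (fun z => (fockWeight σ z : ℂ) * G z) 2)
    (hF' : MemLp (fun z => (fockWeight σ z : ℂ) * F' z) 2)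
    (hG' : MemLp (fun z => (fockWeight σ z : ℂ) * G' z) 2) :
    scalarProduct measure (pairFun σ F G ∘ companionPair ν μ)
        (pairFun σ F' G' ∘ companionPair ν μ) =
      ((Real.pi / (2 * σ) : ℝ) * ∫ z : ℂ, ((fockWeight σ z : ℂ) * F z) *
        (starRingEnd ℂ) ((fockWeight σ z : ℂ) * F' z)) • ePlus +
      ((Real.pi / (2 * σ) : ℝ) * ∫ z : ℂ, ((fockWeight σ z : ℂ) * G z) *
        (starRingEnd ℂ) ((fockWeight σ z : ℂ) * G' z)) • eMinus := by
  have h1 := memLp_pairFun σ hσ hF hG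
  have h2 := memLp_pairFun σ hσ hF' hG'
  have h4 : ((4 : ℝ≥0∞)⁻¹).toReal = 1 / 4 := by simp
  have hc : ((2 * Real.pi / σ : ℝ) : ℂ) * (1 / 4) = (Real.pi / (2 * σ) : ℝ) := by
    have : (σ : ℂ) ≠ 0 := by exact_mod_cast hσ.ne'
    push_cast
    field_simp
    norm_num
  rw [scalarProduct_comp (measurePreserving_companionPair hν hμ) h1 h2]
  apply ext_plus_minus
  · rw [plus_scalarProduct h1 h2, integral_smul_measure, h4]
    simp only [plus_add, plus_smul, plus_ePlus, plus_eMinus, mul_one, mul_zero, add_zero]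
    have e : ∀ p : ℂ × ℂ, plus (pairFun σ F G p) * (starRingEnd ℂ) (plus (pairFun σ F' G' p)) =
        (((fockWeight σ p.1 : ℂ) * F p.1) * (starRingEnd ℂ) ((fockWeight σ p.1 : ℂ) * F' p.1)) *
          ((fockWeight σ p.2 : ℂ) * (starRingEnd ℂ) (fockWeight σ p.2 : ℂ)) := fun p => by
      rw [plus_pairFun, plus_pairFun, map_mul (starRingEnd ℂ) _ (fockWeight σ p.2 : ℂ)]; ring
    simp_rw [e]
    rw [Measure.volume_eq_prod, integral_prod_mul (fun z : ℂ => ((fockWeight σ z : ℂ) * F z) *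
        (starRingEnd ℂ) ((fockWeight σ z : ℂ) * F' z)) (fun z : ℂ => (fockWeight σ z : ℂ) *
          (starRingEnd ℂ) (fockWeight σ z : ℂ)), integral_fockWeight_mul_conj σ hσ, ← hc,
      Complex.real_smul]
    push_cast
    ring
  · rw [minus_scalarProduct h1 h2, integral_smul_measure, h4]
    simp only [minus_add, minus_smul, minus_ePlus, minus_eMinus, mul_one, mul_zero, zero_add]
    have e : ∀ p : ℂ × ℂ, minus (pairFun σ F G p) * (starRingEnd ℂ) (minus (pairFun σ F' G' p)) =
        ((fockWeight σ p.1 : ℂ) * (starRingEnd ℂ) (fockWeight σ p.1 : ℂ)) *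
        (((fockWeight σ p.2 : ℂ) * G p.2) * (starRingEnd ℂ) ((fockWeight σ p.2 : ℂ) * G' p.2)) :=
      fun p => by
      rw [minus_pairFun, minus_pairFun, map_mul (starRingEnd ℂ) (fockWeight σ p.1 : ℂ)]; ring
    simp_rw [e]
    rw [Measure.volume_eq_prod, integral_prod_mul (fun z : ℂ => (fockWeight σ z : ℂ) *
          (starRingEnd ℂ) (fockWeight σ z : ℂ)) (fun z : ℂ => ((fockWeight σ z : ℂ) * G z) *
        (starRingEnd ℂ) ((fockWeight σ z : ℂ) * G' z)), integral_fockWeight_mul_conj σ hσ, ← hc,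
      Complex.real_smul]
    push_cast
    ring

end

/-! ### Reduction of the bicomplex transform to the scalar one -/

/-- Twisting the point absorbs the choice of the root `w`: the real part is unchanged and `w y = i
Im (twist w z)`, so both roots lead to the same scalar transform. -/
theorem wave_exponent {w : ℂ} (h : w ^ 2 = -1) (σ t : ℝ) (z : ℂ) :
    (σ : ℂ) * (w * (t - ((1 / 2 : ℝ) : ℂ) * z.re) * z.im) =
      Complex.I * σ * (t - (twist w z).re / 2) * (twist w z).im := by
  rw [twist_re h]
  have := twist_im_mul h z
  push_cast
  linear_combination -(σ * (t - z.re / 2) : ℂ) * this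

theorem plus_fourierWignerIntegrand (σ : ℝ) {ν : Bicomplex} (hν : ν ^ 2 = -1) (μ : Bicomplex)
    (n : ℕ) (f : ℝ → Bicomplex) (Z : Bicomplex) (t : ℝ) :
    plus (fourierWignerIntegrand σ ν μ f (hermiteWindow σ n) Z t) =
      plus (f t) * (Complex.exp (Complex.I * σ * (t - (twist (plus ν) Z.re).re / 2) *
        (twist (plus ν) Z.re).im) * hermiteFunction σ n (t - (twist (plus ν) Z.re).re)) := by
  rw [← wave_exponent (plus_sq_eq hν), twist_re (plus_sq_eq hν)]
  simp only [fourierWignerIntegrand, modulation, translation, hermiteWindow, Xe, Ye, plus_mul,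
    plus_exp, plus_real_smul, plus_add, plus_sub, plus_ofReal, plus_smul, plus_conj, plus_ePlus,
    plus_eMinus, mul_one, mul_zero, add_zero, Complex.conj_ofReal]

theorem minus_fourierWignerIntegrand (σ : ℝ) (ν : Bicomplex) {μ : Bicomplex} (hμ : μ ^ 2 = -1)
    (n : ℕ) (f : ℝ → Bicomplex) (Z : Bicomplex) (t : ℝ) :
    minus (fourierWignerIntegrand σ ν μ f (hermiteWindow σ n) Z t) =
      minus (f t) * (Complex.exp (Complex.I * σ * (t - (twist (minus μ) Z.im).re / 2) *
        (twist (minus μ) Z.im).im) * hermiteFunction σ n (t - (twist (minus μ) Z.im).re)) := by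
  rw [← wave_exponent (minus_sq_eq hμ), twist_re (minus_sq_eq hμ)]
  simp only [fourierWignerIntegrand, modulation, translation, hermiteWindow, Xe, Ye, minus_mul,
    minus_exp, minus_real_smul, minus_add, minus_sub, minus_ofReal, minus_smul, minus_conj,
    minus_ePlus, minus_eMinus, mul_one, mul_zero, zero_add, Complex.conj_ofReal]

theorem integrable_wave (σ : ℝ) (hσ : 0 < σ) (n : ℕ) {φ : ℝ → ℂ} (hφ : MemLp φ 2) (z : ℂ) :
    Integrable (fun t : ℝ => φ t * (Complex.exp (Complex.I * σ * (t - z.re / 2) * z.im) *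
      hermiteFunction σ n (t - z.re))) := by
  have h := (integrable_mul_kernel_mul_eval σ hσ hφ (hermitePoly σ n) z z.re).const_mul
    ((Real.exp (σ / 4 * ‖z‖ ^ 2) : ℂ)⁻¹)
  refine h.congr (Filter.Eventually.of_forall fun t => ?_)
  have : (Real.exp (σ / 4 * ‖z‖ ^ 2) : ℂ) ≠ 0 := by exact_mod_cast (Real.exp_pos _).ne'
  simp only [kernel_mul_eval_eq]
  field_simp

theorem integrable_fourierWignerIntegrand {σ : ℝ} (hσ : 0 < σ) {ν μ : Bicomplex}
    (hν : ν ^ 2 = -1) (hμ : μ ^ 2 = -1) (n : ℕ) {f : ℝ → Bicomplex} (hf : MemLp f 2)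
    (Z : Bicomplex) : Integrable (fourierWignerIntegrand σ ν μ f (hermiteWindow σ n) Z) := by
  refine integrable_of_plus_minus ?_ ?_
  · simp_rw [plus_fourierWignerIntegrand σ hν]
    exact integrable_wave σ hσ n (memLp_plus hf) _
  · simp_rw [minus_fourierWignerIntegrand σ ν hμ]
    exact integrable_wave σ hσ n (memLp_minus hf) _

/-- The normalizing constant of the transform `S_n`. -/
def hermiteConst (σ : ℝ) (n : ℕ) : ℝ :=
  (σ / Real.pi) ^ (1 / 4 : ℝ) / Real.sqrt (2 ^ n * σ ^ n * (n.factorial : ℝ)) * (σ / Real.pi)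

theorem hermiteConst_pos {σ : ℝ} (hσ : 0 < σ) (n : ℕ) : 0 < hermiteConst σ n := by
  have := Real.pi_pos
  unfold hermiteConst
  positivity

/-- The normalization exactly cancels `‖h_n^σ‖²`, the Moyal factor `2π/σ` and the mass `π/(2σ)` of
the spare variable. -/
theorem hermiteConst_sq_mul {σ : ℝ} (hσ : 0 < σ) (n : ℕ) :
    Real.pi / (2 * σ) * (hermiteConst σ n ^ 2 * moyalConst σ n n) = 1 := by
  have hpi := Real.pi_pos
  have h1 : ((σ / Real.pi) ^ (1 / 4 : ℝ)) ^ 2 = Real.sqrt (σ / Real.pi) := by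
    rw [← Real.rpow_natCast, ← Real.rpow_mul (by positivity), Real.sqrt_eq_rpow]
    norm_num
  have h2 : Real.sqrt (σ / Real.pi) * Real.sqrt (Real.pi / σ) = 1 := by
    rw [← Real.sqrt_mul (by positivity), div_mul_div_cancel₀ hpi.ne', div_self hσ.ne',
      Real.sqrt_one]
  rw [hermiteConst, moyalConst, integral_hermiteFunction_mul_self σ hσ, mul_pow, div_pow, h1,
    Real.sq_sqrt (by positivity)]
  have h3 : (0 : ℝ) < 2 ^ n * σ ^ n * n.factorial := by positivity
  set K : ℝ := 2 ^ n * σ ^ n * n.factorial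
  calc _ = Real.sqrt (σ / Real.pi) * Real.sqrt (Real.pi / σ) := by field_simp
    _ = 1 := h2

/-- The dagger exchanges the idempotents, so the prefactor carries into the plus component the
Gaussian in the second variable, which the integral there does not produce. -/
theorem plus_exp_dagger (σ : ℝ) {μ : Bicomplex} (hμ : μ ^ 2 = -1) (Z : Bicomplex) :
    plus (exp (-((σ / 4) • (dagger (Xe Z) ^ 2 + dagger (Ye Z) ^ 2)))) =
      fockWeight σ (twist (minus μ) Z.im) := by
  rw [fockWeight, norm_twist_sq (minus_sq_eq hμ), Complex.ofReal_exp]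
  simp only [Xe, Ye, sq, plus_exp, plus_neg, plus_real_smul, plus_add, plus_mul, plus_dagger,
    minus_add, minus_real_smul, minus_ePlus, minus_eMinus]
  congr 1
  push_cast
  ring

theorem minus_exp_dagger (σ : ℝ) {ν : Bicomplex} (hν : ν ^ 2 = -1) (Z : Bicomplex) :
    minus (exp (-((σ / 4) • (dagger (Xe Z) ^ 2 + dagger (Ye Z) ^ 2)))) =
      fockWeight σ (twist (plus ν) Z.re) := by
  rw [fockWeight, norm_twist_sq (plus_sq_eq hν), Complex.ofReal_exp]
  simp only [Xe, Ye, sq, minus_exp, minus_neg, minus_real_smul, minus_add, minus_mul, minus_dagger,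
    plus_add, plus_real_smul, plus_ePlus, plus_eMinus]
  congr 1
  push_cast
  ring

/-- The bridge to the scalar theory: one weight comes from the dagger prefactor, the other from
`waveTransform`. -/
theorem hermiteTransform_eq {σ : ℝ} (hσ : 0 < σ) {ν μ : Bicomplex} (hν : ν ^ 2 = -1)
    (hμ : μ ^ 2 = -1) (n : ℕ) {f : ℝ → Bicomplex} (hf : MemLp f 2) :
    hermiteTransform σ ν μ n f =
      pairFun σ (bargmann σ n (fun t => (hermiteConst σ n : ℂ) * plus (f t)))
        (bargmann σ n (fun t => (hermiteConst σ n : ℂ) * minus (f t))) ∘ companionPair ν μ := by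
  funext Z
  have hint := integrable_fourierWignerIntegrand hσ hν hμ n hf Z
  rw [Function.comp_apply]
  apply ext_plus_minus
  · rw [plus_pairFun, companionPair, bargmann_const_mul, hermiteTransform, fourierWigner,
      plus_real_smul, plus_real_smul, plus_mul, plus_exp_dagger σ hμ, plus_integral hint]
    simp_rw [plus_fourierWignerIntegrand σ hν]
    rw [← waveTransform_eq_integral, waveTransform_eq, hermiteConst]
    push_cast
    ring
  · rw [minus_pairFun, companionPair, bargmann_const_mul, hermiteTransform, fourierWigner,
      minus_real_smul, minus_real_smul, minus_mul, minus_exp_dagger σ hν, minus_integral hint]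
    simp_rw [minus_fourierWignerIntegrand σ ν hμ]
    rw [← waveTransform_eq_integral σ n (fun t => minus (f t)), waveTransform_eq, hermiteConst]
    push_cast
    ring

theorem hermiteTransform_congr_ae (σ : ℝ) (ν μ : Bicomplex) (n : ℕ) {f g : ℝ → Bicomplex}
    (h : f =ᵐ[volume] g) : hermiteTransform σ ν μ n f = hermiteTransform σ ν μ n g := by
  funext Z
  have : ∫ t, fourierWignerIntegrand σ ν μ f (hermiteWindow σ n) Z t =
      ∫ t, fourierWignerIntegrand σ ν μ g (hermiteWindow σ n) Z t := by
    refine integral_congr_ae ?_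
    filter_upwards [h] with t ht
    rw [fourierWignerIntegrand, fourierWignerIntegrand, ht]
  rw [hermiteTransform, hermiteTransform, fourierWigner, fourierWigner, this]

theorem memLp_const_mul {f : ℝ → Bicomplex} (c : Bicomplex) (hf : MemLp f 2) :
    MemLp (fun t => c * f t) 2 := by
  refine memLp_of_plus_minus ?_ ?_
  · simp_rw [plus_mul]; exact (memLp_plus hf).const_mul _
  · simp_rw [minus_mul]; exact (memLp_minus hf).const_mul _

theorem hermiteTransform_linear {σ : ℝ} (hσ : 0 < σ) {ν μ : Bicomplex} (hν : ν ^ 2 = -1)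
    (hμ : μ ^ 2 = -1) (n : ℕ) (c : Bicomplex) {f g : ℝ → Bicomplex} (hf : MemLp f 2)
    (hg : MemLp g 2) (Z : Bicomplex) :
    hermiteTransform σ ν μ n (fun t => c * f t + g t) Z =
      c * hermiteTransform σ ν μ n f Z + hermiteTransform σ ν μ n g Z := by
  have hcfg : MemLp (fun t => c * f t + g t) 2 := (memLp_const_mul c hf).add hg
  rw [hermiteTransform_eq hσ hν hμ n hf, hermiteTransform_eq hσ hν hμ n hg,
    hermiteTransform_eq hσ hν hμ n hcfg]
  simp only [Function.comp_apply]
  apply ext_plus_minus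
  · rw [plus_add, plus_mul, plus_pairFun, plus_pairFun, plus_pairFun]
    simp only [bargmann_const_mul, plus_add, plus_mul]
    rw [bargmann_add σ hσ n ((memLp_plus hf).const_mul _) (memLp_plus hg), bargmann_const_mul]
    ring
  · rw [minus_add, minus_mul, minus_pairFun, minus_pairFun, minus_pairFun]
    simp only [bargmann_const_mul, minus_add, minus_mul]
    rw [bargmann_add σ hσ n ((memLp_minus hf).const_mul _) (memLp_minus hg), bargmann_const_mul]
    ring

theorem hermiteTransform_mem {σ : ℝ} (hσ : 0 < σ) {ν μ : Bicomplex} (hν : ν ^ 2 = -1)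
    (hμ : μ ^ 2 = -1) (n : ℕ) {f : ℝ → Bicomplex} (hf : MemLp f 2) :
    hermiteTransform σ ν μ n f ∈ trueCompanionSpace σ ν μ n :=
  (mem_trueCompanionSpace_iff σ ν μ n _).2
    ⟨_, bargmann_mem_truePolyFock σ hσ n ((memLp_plus hf).const_mul _),
      _, bargmann_mem_truePolyFock σ hσ n ((memLp_minus hf).const_mul _),
      hermiteTransform_eq hσ hν hμ n hf⟩

theorem memLp_of_mem_trueCompanionSpace {σ : ℝ} (hσ : 0 < σ) {ν μ : Bicomplex} (hν : ν ^ 2 = -1)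
    (hμ : μ ^ 2 = -1) (n : ℕ) {Υ : Bicomplex → Bicomplex} (h : Υ ∈ trueCompanionSpace σ ν μ n) :
    MemLp Υ 2 measure := by
  obtain ⟨F, hF, G, hG, rfl⟩ := (mem_trueCompanionSpace_iff σ ν μ n Υ).1 h
  exact memLp_pairFun_comp hσ hν hμ ((mem_polyFock_iff σ _ _).1 hF.1).2
    ((mem_polyFock_iff σ _ _).1 hG.1).2

theorem exists_hermiteTransform_eq {σ : ℝ} (hσ : 0 < σ) {ν μ : Bicomplex} (hν : ν ^ 2 = -1)
    (hμ : μ ^ 2 = -1) (n : ℕ) {Υ : Bicomplex → Bicomplex} (h : Υ ∈ trueCompanionSpace σ ν μ n) :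
    ∃ f : ℝ → Bicomplex, MemLp f 2 ∧ hermiteTransform σ ν μ n f = Υ := by
  obtain ⟨F, hF, G, hG, rfl⟩ := (mem_trueCompanionSpace_iff σ ν μ n Υ).1 h
  obtain ⟨φ, hφ, rfl⟩ := exists_bargmann_eq_of_mem_truePolyFock σ hσ n hF
  obtain ⟨ψ, hψ, rfl⟩ := exists_bargmann_eq_of_mem_truePolyFock σ hσ n hG
  have hK : (hermiteConst σ n : ℂ) ≠ 0 := by exact_mod_cast (hermiteConst_pos hσ n).ne'
  -- The preimage is assembled from the scalar preimages, divided by the constant that the transform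
  -- multiplies in.
  have hf : MemLp (fun t => ((hermiteConst σ n : ℂ)⁻¹ * φ t) • ePlus +
      ((hermiteConst σ n : ℂ)⁻¹ * ψ t) • eMinus) 2 :=
    memLp_smul_add_smul (hφ.const_mul _) (hψ.const_mul _)
  refine ⟨_, hf, ?_⟩
  rw [hermiteTransform_eq hσ hν hμ n hf]
  simp only [plus_add, plus_smul, plus_ePlus, plus_eMinus, minus_add, minus_smul, minus_ePlus,
    minus_eMinus, mul_one, mul_zero, add_zero, zero_add, mul_inv_cancel_left₀ hK]

theorem scalarProduct_hermiteTransform {σ : ℝ} (hσ : 0 < σ) {ν μ : Bicomplex} (hν : ν ^ 2 = -1)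
    (hμ : μ ^ 2 = -1) (n : ℕ) {f g : ℝ → Bicomplex} (hf : MemLp f 2) (hg : MemLp g 2) :
    scalarProduct measure (hermiteTransform σ ν μ n f) (hermiteTransform σ ν μ n g) =
      scalarProduct volume f g := by
  have hc : ((Real.pi / (2 * σ) : ℝ) : ℂ) * ((hermiteConst σ n : ℂ) ^ 2 * moyalConst σ n n) = 1 := by
    exact_mod_cast hermiteConst_sq_mul hσ n
  have key : ∀ φ ψ : ℝ → ℂ, MemLp φ 2 → MemLp ψ 2 →
      ((Real.pi / (2 * σ) : ℝ) : ℂ) * ∫ z : ℂ,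
        ((fockWeight σ z : ℂ) * bargmann σ n (fun t => (hermiteConst σ n : ℂ) * φ t) z) *
        (starRingEnd ℂ) ((fockWeight σ z : ℂ) *
          bargmann σ n (fun t => (hermiteConst σ n : ℂ) * ψ t) z) =
      ∫ t, φ t * (starRingEnd ℂ) (ψ t) := by
    intro φ ψ hφ hψ
    rw [integral_weighted_bargmann σ hσ n n (hφ.const_mul _) (hψ.const_mul _)]
    have e : ∀ t, (hermiteConst σ n : ℂ) * φ t * (starRingEnd ℂ) ((hermiteConst σ n : ℂ) * ψ t) =
        (hermiteConst σ n : ℂ) ^ 2 * (φ t * (starRingEnd ℂ) (ψ t)) := fun t => by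
      rw [map_mul, Complex.conj_ofReal]; ring
    simp_rw [e]
    rw [integral_const_mul]
    linear_combination (∫ t, φ t * (starRingEnd ℂ) (ψ t)) * hc
  have hm : ∀ φ : ℝ → ℂ, MemLp φ 2 → MemLp (fun z => (fockWeight σ z : ℂ) *
      bargmann σ n (fun t => (hermiteConst σ n : ℂ) * φ t) z) 2 := fun φ hφ =>
    memLp_fockWeight_mul_bargmann σ hσ n (hφ.const_mul _)
  rw [hermiteTransform_eq hσ hν hμ n hf, hermiteTransform_eq hσ hν hμ n hg,
    scalarProduct_pairFun_comp hσ hν hμ (hm _ (memLp_plus hf)) (hm _ (memLp_minus hf))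
      (hm _ (memLp_plus hg)) (hm _ (memLp_minus hg)),
    key _ _ (memLp_plus hf) (memLp_plus hg), key _ _ (memLp_minus hf) (memLp_minus hg),
    ← plus_scalarProduct hf hg, ← minus_scalarProduct hf hg, ← idempotent_decomposition]

theorem memLp_hermiteTransform {σ : ℝ} (hσ : 0 < σ) {ν μ : Bicomplex} (hν : ν ^ 2 = -1)
    (hμ : μ ^ 2 = -1) (n : ℕ) {f : ℝ → Bicomplex} (hf : MemLp f 2) :
    MemLp (hermiteTransform σ ν μ n f) 2 measure :=
  memLp_of_mem_trueCompanionSpace hσ hν hμ n (hermiteTransform_mem hσ hν hμ n hf)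

theorem eLpNorm_hermiteTransform {σ : ℝ} (hσ : 0 < σ) {ν μ : Bicomplex} (hν : ν ^ 2 = -1)
    (hμ : μ ^ 2 = -1) (n : ℕ) {f : ℝ → Bicomplex} (hf : MemLp f 2) :
    eLpNorm (hermiteTransform σ ν μ n f) 2 measure = eLpNorm f 2 volume :=
  eLpNorm_two_eq_of_scalarProduct_eq (memLp_hermiteTransform hσ hν hμ n hf) hf
    (scalarProduct_hermiteTransform hσ hν hμ n hf hf)

/-! ### Closedness of the target space -/

/-- The transform `S_n` between the `L²` spaces. -/
def hermiteTransformLp {σ : ℝ} (hσ : 0 < σ) {ν μ : Bicomplex} (hν : ν ^ 2 = -1)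
    (hμ : μ ^ 2 = -1) (n : ℕ) :
    Lp Bicomplex 2 (volume : Measure ℝ) →+ Lp Bicomplex 2 measure :=
  AddMonoidHom.mk' (fun f => (memLp_hermiteTransform hσ hν hμ n (Lp.memLp f)).toLp) fun f g => by
    rw [← MemLp.toLp_add]
    refine MemLp.toLp_congr _ _ (Filter.Eventually.of_forall fun Z => ?_)
    have h := hermiteTransform_linear hσ hν hμ n 1 (Lp.memLp f) (Lp.memLp g) Z
    simp only [one_mul] at h
    rw [Pi.add_apply, hermiteTransform_congr_ae σ ν μ n (Lp.coeFn_add f g), ← h]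
    rfl

theorem isometry_hermiteTransformLp {σ : ℝ} (hσ : 0 < σ) {ν μ : Bicomplex} (hν : ν ^ 2 = -1)
    (hμ : μ ^ 2 = -1) (n : ℕ) : Isometry (hermiteTransformLp hσ hν hμ n) := by
  refine AddMonoidHomClass.isometry_of_norm _ fun f => ?_
  change ‖(memLp_hermiteTransform hσ hν hμ n (Lp.memLp f)).toLp‖ = ‖f‖
  rw [Lp.norm_toLp, eLpNorm_hermiteTransform hσ hν hμ n (Lp.memLp f), Lp.norm_def]

theorem isClosed_trueCompanionSpace {σ : ℝ} (hσ : 0 < σ) {ν μ : Bicomplex} (hν : ν ^ 2 = -1)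
    (hμ : μ ^ 2 = -1) (n : ℕ) :
    IsClosed {u : Lp Bicomplex 2 measure | ∃ Υ ∈ trueCompanionSpace σ ν μ n, u =ᵐ[measure] Υ} := by
  have h : {u : Lp Bicomplex 2 measure | ∃ Υ ∈ trueCompanionSpace σ ν μ n, u =ᵐ[measure] Υ} =
      -- The classes of target functions are exactly the values of the isometry, and the isometric
      -- image of a complete space is closed.
      Set.range (hermiteTransformLp hσ hν hμ n) := by
    ext u
    constructor
    · rintro ⟨Υ, hΥ, hu⟩
      obtain ⟨f, hf, rfl⟩ := exists_hermiteTransform_eq hσ hν hμ n hΥ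
      refine ⟨hf.toLp, Lp.ext ?_⟩
      have h1 := (memLp_hermiteTransform hσ hν hμ n (Lp.memLp (hf.toLp f))).coeFn_toLp
      have h2 := hermiteTransform_congr_ae σ ν μ n hf.coeFn_toLp
      exact (h1.trans (Filter.Eventually.of_forall fun Z => congrFun h2 Z)).trans hu.symm
    · rintro ⟨f, rfl⟩
      exact ⟨_, hermiteTransform_mem hσ hν hμ n (Lp.memLp f),
        (memLp_hermiteTransform hσ hν hμ n (Lp.memLp f)).coeFn_toLp⟩
  rw [h]
  exact (isometry_hermiteTransformLp hσ hν hμ n).isClosedEmbedding.isClosed_range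

end Bicomplex

end

theorem mainTheorem3 (σ : ℝ) (hσ : 0 < σ) (ν μ : Bicomplex) (hν : ν ^ 2 = -1) (hμ : μ ^ 2 = -1)
    (n : ℕ) :
    -- the transform is well defined on `L²` classes, with values in the target space
    (∀ f : ℝ → Bicomplex, MemLp f 2 volume →
      (∀ Z, Integrable
        (Bicomplex.fourierWignerIntegrand σ ν μ f (Bicomplex.hermiteWindow σ n) Z)) ∧
      Bicomplex.hermiteTransform σ ν μ n f ∈ Bicomplex.trueCompanionSpace σ ν μ n) ∧
    (∀ f g : ℝ → Bicomplex, f =ᵐ[volume] g →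
      Bicomplex.hermiteTransform σ ν μ n f = Bicomplex.hermiteTransform σ ν μ n g) ∧
    -- it is linear over the bicomplex numbers
    (∀ (c : Bicomplex) (f g : ℝ → Bicomplex), MemLp f 2 volume → MemLp g 2 volume → ∀ Z,
      Bicomplex.hermiteTransform σ ν μ n (fun t => c * f t + g t) Z =
        c * Bicomplex.hermiteTransform σ ν μ n f Z + Bicomplex.hermiteTransform σ ν μ n g Z) ∧
    -- the target space is a closed subspace of `L²`, hence a Hilbert space
    (∀ Υ ∈ Bicomplex.trueCompanionSpace σ ν μ n, MemLp Υ 2 Bicomplex.measure) ∧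
    IsClosed {u : Lp Bicomplex 2 Bicomplex.measure |
      ∃ Υ ∈ Bicomplex.trueCompanionSpace σ ν μ n, u =ᵐ[Bicomplex.measure] Υ} ∧
    -- the bicomplex scalar product and the norm are preserved
    (∀ f g : ℝ → Bicomplex, MemLp f 2 volume → MemLp g 2 volume →
      Bicomplex.scalarProduct Bicomplex.measure (Bicomplex.hermiteTransform σ ν μ n f)
          (Bicomplex.hermiteTransform σ ν μ n g) =
        Bicomplex.scalarProduct volume f g) ∧
    (∀ f : ℝ → Bicomplex, MemLp f 2 volume →
      eLpNorm (Bicomplex.hermiteTransform σ ν μ n f) 2 Bicomplex.measure =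
        eLpNorm f 2 volume) ∧
    -- the transform is onto
    (∀ Υ ∈ Bicomplex.trueCompanionSpace σ ν μ n, ∃ f : ℝ → Bicomplex, MemLp f 2 volume ∧
      Bicomplex.hermiteTransform σ ν μ n f = Υ) := by
  refine ⟨fun f hf => ⟨Bicomplex.integrable_fourierWignerIntegrand hσ hν hμ n hf,
      Bicomplex.hermiteTransform_mem hσ hν hμ n hf⟩,
    fun f g => Bicomplex.hermiteTransform_congr_ae σ ν μ n,
    fun c f g => Bicomplex.hermiteTransform_linear hσ hν hμ n c,
    fun Υ => Bicomplex.memLp_of_mem_trueCompanionSpace hσ hν hμ n,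
    Bicomplex.isClosed_trueCompanionSpace hσ hν hμ n,
    fun f g => Bicomplex.scalarProduct_hermiteTransform hσ hν hμ n,
    fun f => Bicomplex.eLpNorm_hermiteTransform hσ hν hμ n,
    fun Υ => Bicomplex.exists_hermiteTransform_eq hσ hν hμ n⟩
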